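/- Let $B_\infty$ be the graph with vertex set $\mathbb Z$ and two edges joining $i$ and $i+1$ for every $i$, and let $\hat B_n$ be the $n$-cycle with vertex set $\mathbb Z_n$, every edge doubled, and vertex $0$ distinguished as a sink. A non-sink vertex $v$ is unstable if it holds at least $d_v$ particles ($d_v$ the number of edges incident to $v$; here $d_v=4$); it topples by sending one particle along each incident edge, and particles arriving at a sink disappear. On a finite connected graph with sinks, the stabilization $\sigma^\circ$ of $\sigma$ is the stable configuration reached by toppling unstable vertices. The threshold density $\zeta_c(\Gamma)\ge 0$ of an infinite graph $\Gamma$ is the number such that independent Poisson($\lambda$) numbers of particles at the vertices stabilize on $\Gamma$ (every vertex topples finitely often when all unstable vertices are toppled simultaneously at each time step) with probability $1$ if $\lambda<\zeta_c(\Gamma)$ and with probability $0$ if $\lambda>\zeta_c(\Gamma)$. The stationary density $\zeta_s(\hat G)$ of a finite connected graph with sinks is the expected average number of particles per non-sink vertex under the uniform measure on recurrent configurations, i.e. the stable configurations that are visited with probability $1$, from every stable initial configuration, by the Markov chain which repeatedly adds a particle at a uniformly random non-sink vertex and stabilizes. For an infinite graph $\Gamma$, $\zeta_s(\Gamma)=\lim_{n}\zeta_s(\hat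 G_n)$, where $\hat G_0\subset\hat G_1\subset\cdots$ are finite connected induced subgraphs with union $\Gamma$, $\hat G_{n}$ contains all neighbours of $\hat G_{n-1}$, and the sinks of $\hat G_n$ are the vertices in $\hat G_n\setminus\hat G_{n-1}$; the limit is required to exist and be the same for every such sequence. Theorem (bracelet graph). 1. The threshold density $\zeta_c=\zeta_c(B_\infty)$ is the unique positive root of $\zeta=\frac52-\frac12e^{-2\zeta}$ (numerically, $\zeta_c = 2.496608$ to six decimal places). 2. The stationary density is $\zeta_s(B_\infty)=\frac52$; also $\zeta_s(\hat B_n)\to\frac52$ as $n\to\infty$. 3. For $\lambda>0$ let $\sigma_\lambda$ consist of independent Poisson($\lambda$) numbers of particles at the non-sink vertices of $\hat B_n$, let $\eta_\lambda=(\sigma_\lambda)^\circ$, and let $\rho_n(\lambda)=\frac1{n-1}\sum_{x=1}^{n-1}\eta_\lambda(x)$. Then $\rho_n(\lambda)\to\rho(\lambda)$ in probability as $n\to\infty$, where $$\rho(\lambda)=\min\left(\lambda,\frac{5-e^{-2\lambda}}2\right)=\begin{cases}\lambda,&\lambda\le\zeta_c,\\ \frac{5-e^{-2\lambda}}2,&\lambda>\zeta_c.\end{cases}$$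 In particular $\rho$ has a second-order phase transition at $\zeta_c$: it is continuous at $\zeta_c$ and differentiable near $\zeta_c$ except at $\zeta_c$, and its derivative has different one-sided limits at $\zeta_c$. -/

import Mathlib

open MeasureTheory ProbabilityTheory Filter Topology Set
open scoped NNReal ENNReal

/-- A locally finite undirected multigraph, given by the number `mult v w` of edges connecting
`v` and `w`. -/
structure Multigraph (V : Type*) where
  mult : V → V → ℕ
  symm : ∀ v w, mult v w = mult w v
  locallyFinite : ∀ v, {w | mult v w ≠ 0}.Finite

/-- The law of independent Poisson(`r`) particle numbers at the elements of `V`. -/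
noncomputable def poissonField (V : Type*) (r : ℝ≥0) : Measure (V → ℕ) :=
  Measure.infinitePi fun _ : V => poissonMeasure r

namespace Multigraph

variable {V : Type*}

/-- The number of edges incident to `v`. -/
noncomputable def degree (G : Multigraph V) (v : V) : ℕ := ∑ᶠ w, G.mult v w

/-- The subgraph induced on the vertex set `W`. -/
def induce (G : Multigraph V) (W : Set V) : Multigraph W where
  mult v w := G.mult v w
  symm v w := G.symm v w
  locallyFinite v := (G.locallyFinite v).preimage Subtype.val_injective.injOn

/-! ### The fixed-energy sandpile (no sinks) and the threshold density -/

open Classical in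
/-- One step of parallel toppling: every vertex holding at least as many particles as its degree
sends one particle along each incident edge. -/
noncomputable def parallelStep (G : Multigraph V) (η : V → ℕ) : V → ℕ := fun w =>
  (if G.degree w ≤ η w then η w - G.degree w else η w) +
    ∑ᶠ v, if G.degree v ≤ η v then G.mult v w else 0

/-- `η` stabilizes: under parallel toppling every vertex topples only finitely many times. -/
def Stabilizes (G : Multigraph V) (η : V → ℕ) : Prop :=
  ∀ v, ∃ N, ∀ j ≥ N, (G.parallelStep^[j] η) v < G.degree v

/-- `ζ` is the threshold density of the infinite graph `G`: independent Poisson(`r`) particle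
numbers stabilize with probability `1` if `r < ζ`, and with probability `0` if `r > ζ`. -/
def IsThresholdDensity (G : Multigraph V) (ζ : ℝ) : Prop :=
  0 ≤ ζ ∧ ∀ r : ℝ≥0,
    ((r : ℝ) < ζ → ∀ᵐ σ ∂poissonField V r, G.Stabilizes σ) ∧
    (ζ < (r : ℝ) → ∀ᵐ σ ∂poissonField V r, ¬ G.Stabilizes σ)

/-! ### The driven dissipative sandpile (with a set `S` of sinks) and the stationary density -/

/-- Sandpiles on a graph with sink set `S`: particle numbers at the non-sink vertices. Particles
arriving at a sink are removed. -/
abbrev Sandpile (S : Set V) : Type _ := {v : V // v ∉ S} → ℕ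

/-- The average number of particles per non-sink vertex. -/
noncomputable def density {S : Set V} (η : Sandpile S) : ℝ :=
  (∑ᶠ v, (η v : ℝ)) / (Nat.card {v : V // v ∉ S} : ℝ)

open Classical in
/-- The result of toppling the non-sink vertex `v`. -/
noncomputable def topple (G : Multigraph V) {S : Set V} (η : Sandpile S) (v : {v : V // v ∉ S}) :
    Sandpile S :=
  fun w => (if w = v then η w - G.degree v else η w) + G.mult v w

/-- `η'` results from `η` by toppling one unstable non-sink vertex. -/
def TopplesTo (G : Multigraph V) {S : Set V} (η η' : Sandpile S) : Prop :=
  ∃ v : {v : V // v ∉ S}, G.degree v ≤ η v ∧ η' = G.topple η v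

def IsStable (G : Multigraph V) {S : Set V} (η : Sandpile S) : Prop :=
  ∀ v : {v : V // v ∉ S}, η v < G.degree v

/-- `η'` is stable and is reached from `η` by finitely many topplings of unstable vertices. -/
def IsStabilization (G : Multigraph V) {S : Set V} (η η' : Sandpile S) : Prop :=
  Relation.ReflTransGen G.TopplesTo η η' ∧ G.IsStable η'

/-- A sandpile has at most one stabilization (the abelian property). -/
theorem IsStabilization.unique {G : Multigraph V} {S : Set V} {η η₁ η₂ : Sandpile S}
    (h₁ : G.IsStabilization η η₁) (h₂ : G.IsStabilization η η₂) : η₁ = η₂ := by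
  have key : ∀ {α β : Sandpile S}, G.IsStable α → Relation.ReflTransGen G.TopplesTo α β →
      α = β := by
    intro α β hα h
    rcases Relation.ReflTransGen.cases_head h with h | ⟨γ, ⟨v, hv, -⟩, -⟩
    · exact h
    · exact absurd (hα v) (not_lt.mpr hv)
  obtain ⟨δ, hd₁, hd₂⟩ := Relation.church_rosser (r := G.TopplesTo) (fun a b c hab hac => by
    obtain ⟨v, hv, rfl⟩ := hab
    obtain ⟨w, hw, rfl⟩ := hac
    by_cases hvw : v = w
    · subst hvw
      exact ⟨_, Relation.ReflGen.refl, Relation.ReflTransGen.refl⟩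
    · have hwv : w ≠ v := fun h => hvw h.symm
      refine ⟨G.topple (G.topple a v) w, Relation.ReflGen.single ⟨w, ?_, rfl⟩,
        Relation.ReflTransGen.single ⟨v, ?_, ?_⟩⟩
      · simp only [topple, if_neg hwv]; omega
      · simp only [topple, if_neg hvw]; omega
      · funext x
        by_cases hxv : x = v
        · subst hxv
          simp only [topple, if_neg hvw, if_true]; omega
        · by_cases hxw : x = w
          · subst hxw
            simp only [topple, if_neg hwv, if_true]; omega
          · simp only [topple, if_neg hxv, if_neg hxw]; omega) h₁.1 h₂.1
  exact (key h₁.2 hd₁).trans (key h₂.2 hd₂).symm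

open Classical in
/-- The stabilization of `η` (by convention `η` itself if there is none, which does not happen on
a finite connected graph with at least one sink). -/
noncomputable def stabilization (G : Multigraph V) {S : Set V} (η : Sandpile S) : Sandpile S :=
  if h : ∃ η', G.IsStabilization η η' then h.choose else η

open Classical in
/-- The states of the driven sandpile started from `η₀` when the `k`-th particle is added at the
vertex `X k`, the sandpile being stabilized after each addition. -/
noncomputable def driven (G : Multigraph V) {S : Set V} (η₀ : Sandpile S)
    (X : ℕ → {v : V // v ∉ S}) : ℕ → Sandpile S
  | 0 => η₀
  | k + 1 => G.stabilization (driven G η₀ X k + Pi.single (X k) 1)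

/-- The law of a sequence of independent uniformly distributed non-sink vertices. -/
noncomputable def uniformSites (S : Set V) :
    @Measure (ℕ → {v : V // v ∉ S}) (@MeasurableSpace.pi _ _ fun _ => ⊤) :=
  @Measure.infinitePi ℕ (fun _ => {v : V // v ∉ S}) (fun _ => ⊤) fun _ => @uniformOn _ ⊤ univ

/-- `η` is recurrent: it is a stable sandpile which, from every initial stable sandpile, is
almost surely visited by the driven sandpile with particles added at independent uniformly
distributed non-sink vertices. -/
def IsRecurrent (G : Multigraph V) {S : Set V} (η : Sandpile S) : Prop :=
  G.IsStable η ∧ ∀ η₀ : Sandpile S, G.IsStable η₀ →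
    ∀ᵐ X ∂uniformSites S, ∃ k, G.driven η₀ X k = η

/-- The stationary density of a finite graph with sink set `S`: the expected density under the
uniform measure on recurrent sandpiles. -/
noncomputable def stationaryDensity (G : Multigraph V) (S : Set V) : ℝ :=
  ∫ η : Sandpile S, density η ∂(uniformOn {η : Sandpile S | G.IsRecurrent η})

/-- A nested family of finite connected vertex sets with union `V`, each containing all neighbours
of the preceding one, so that the new vertices `W (n + 1) \ W n` separate `W n` from the rest. -/
structure IsExhaustion (G : Multigraph V) (W : ℕ → Set V) : Prop where
  finite : ∀ n, (W n).Finite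
  connected : ∀ n, ∀ u ∈ W n, ∀ v ∈ W n,
    Relation.ReflTransGen (fun x y => x ∈ W n ∧ y ∈ W n ∧ G.mult x y ≠ 0) u v
  mono : Monotone W
  union : ⋃ n, W n = univ
  neighbours : ∀ n, ∀ v ∈ W n, ∀ w, G.mult v w ≠ 0 → w ∈ W (n + 1)

/-- `ζ` is the stationary density of the infinite graph `G`: it is the limit of the stationary
densities of the finite subgraphs induced on `W (n + 1)`, with sinks `W (n + 1) \ W n`, along
every exhaustion `W` (and there is one). -/
def HasStationaryDensity (G : Multigraph V) (ζ : ℝ) : Prop :=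
  (∃ W, G.IsExhaustion W) ∧ ∀ W, G.IsExhaustion W →
    Tendsto (fun n => (G.induce (W (n + 1))).stationaryDensity {v | (v : V) ∉ W n}) atTop (𝓝 ζ)

/-! ### Bracelet graphs -/

/-- The graph on `A` with two edges joining `i` and `i + 1` for each `i`. -/
def doubledLine (A : Type*) [AddGroupWithOne A] [DecidableEq A] : Multigraph A where
  mult v w := 2 * ((if w = v + 1 then 1 else 0) + (if v = w + 1 then 1 else 0))
  symm v w := by rw [add_comm]
  locallyFinite v := by
    refine ((finite_singleton (v + 1)).union (finite_singleton (v - 1))).subset fun w hw => ?_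
    by_contra h
    simp only [mem_union, mem_singleton_iff, not_or] at h
    have h2 : v ≠ w + 1 := fun e => h.2 (by rw [e, add_sub_cancel_right])
    simp [h.1, h2] at hw

end Multigraph

/-- The bracelet graph `B_∞`: the path `ℤ` with doubled edges. -/
def infiniteBracelet : Multigraph ℤ := Multigraph.doubledLine ℤ

/-- The bracelet graph `B_n` (for `n ≥ 1`): the `n`-cycle with doubled edges. -/
def bracelet (n : ℕ) : Multigraph (ZMod n) := Multigraph.doubledLine (ZMod n)

/-- The final density on the bracelet with sink `0`, started from the sandpile `σ`. -/
noncomputable def finalDensity (n : ℕ) (σ : Multigraph.Sandpile ({0} : Set (ZMod n))) : ℝ :=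
  Multigraph.density ((bracelet n).stabilization σ)

/-- The limiting final density as a function of the initial density. -/
noncomputable def limitDensity (x : ℝ) : ℝ := min x ((5 - Real.exp (-2 * x)) / 2)

/-- `f` has a second-order phase transition at `c`: it is continuous at `c` and differentiable
near `c` except at `c`, and its derivative has a jump at `c`. -/
def HasSecondOrderTransitionAt (f : ℝ → ℝ) (c : ℝ) : Prop :=
  ContinuousAt f c ∧ (∀ᶠ x in 𝓝[≠] c, DifferentiableAt ℝ f x) ∧
    ∃ a b : ℝ, a ≠ b ∧ Tendsto (deriv f) (𝓝[<] c) (𝓝 a) ∧ Tendsto (deriv f) (𝓝[>] c) (𝓝 b)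

/-!
Toppling a vertex of a doubled line or cycle moves two particles along each double edge, so parities
never change, and the sandpile `η` is governed by the numbers `h = η / 2` of complete pairs: a site
topples when `h ≥ 2`, and then gives one unit to each neighbour. This is the sandpile on a simple
path, which is critical at mean height `1`. For a Poisson(`r`) pile the mean of `h` is
`(r - p) / 2`, where `p = (1 - exp (-2 r)) / 2` is the probability of an odd pile, and it equals `1`
exactly at the root `ζc` of the equation for the threshold (`deficit`).

*Threshold.* The odometer `u` of a stabilizing sandpile satisfies `h + Δu ≤ 1`. If the mean of `h`
exceeds `1`, the law of large numbers makes the slope of such a `u` tend to `-∞`, which is impossible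
for `u ≥ 0` (`not_stabilizes_of_tendsto`). If the mean is below `1`, any solution of `h + Δu = 1` is
nondecreasing outwards far out in both directions, hence bounded
below; adding a constant makes it nonnegative, and by the
least action principle it bounds the odometer (`stabilizes_of_supersolution`).

*Stationary density.* On a path of length `m` with sinks at both ends, call a sandpile packed if
every interval lacks at most one unit of `h`. Toppling and adding particles preserve this
(`PackedOn.insert`). A stable packed sandpile has at most one site with `h = 0`, and is determined by
its parities and by the moment `∑ (k + 1) η_k` modulo `2 (m + 1)`, both of which are toppling
invariants. Hence it can be reached from any stable sandpile, and by independence of the added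
particles it almost surely is (`IsDoubledPath.isRecurrent_iff`). So a recurrent sandpile is given by
arbitrary parities and one of `m + 1` positions for the missing pair, and the stationary density is
`5 / 2 - 2 / (m + 1)`.

*Final density.* The invariant behind packedness also shows that a stretch of toppled sites is
packed at any time, while between two sites that have not toppled no unit has been lost. Therefore the
number of pairs left on a path of length `m` is `min 1 μ * m + o(m)` when the initial heights have
asymptotic mean `μ` (`IsDoubledPath.le_sum_pairs_stabilization`, `tendsto_finalPairs`). Reading all
sandpiles off from one infinite sequence turns this into almost sure convergence of the final density,
which implies convergence in probability.
-/

/-! ### Independent Poisson variables -/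

instance {ι : Type*} (r : ℝ≥0) : IsProbabilityMeasure (poissonField ι r) := by
  unfold poissonField; infer_instance

/-- The strong law of large numbers along an injective enumeration `g` of some of the sites. -/
theorem poissonField_ae_tendsto_average {ι : Type*} (r : ℝ≥0) {g : ℕ → ι}
    (hg : Function.Injective g) {f : ℕ → ℝ} (hf : Integrable f (poissonMeasure r)) :
    ∀ᵐ ω ∂poissonField ι r, Tendsto (fun n : ℕ => (∑ k ∈ Finset.range n, f (ω (g k))) / n) atTop
      (𝓝 (∫ x, f x ∂poissonMeasure r)) := by
  have hmap : ∀ i : ι, (poissonField ι r).map (fun ω => ω i) = poissonMeasure r := fun i =>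
    Measure.infinitePi_map_eval (fun _ : ι => poissonMeasure r) i
  have hmeas : ∀ i : ι, Measurable (fun ω : ι → ℕ => f (ω i)) := fun i =>
    (measurable_of_countable f).comp (measurable_pi_apply i)
  have hmapf : ∀ i : ι, (poissonField ι r).map (fun ω => f (ω i)) = (poissonMeasure r).map f := by
    intro i
    rw [← hmap i, Measure.map_map (measurable_of_countable f) (measurable_pi_apply i)]
    rfl
  have hindep : iIndepFun (fun (i : ι) (ω : ι → ℕ) => f (ω i)) (poissonField ι r) :=
    iIndepFun_infinitePi (P := fun _ : ι => poissonMeasure r) (X := fun _ => f)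
      fun _ => measurable_of_countable f
  have hint : Integrable (fun ω : ι → ℕ => f (ω (g 0))) (poissonField ι r) := by
    have : Integrable f ((poissonField ι r).map (fun ω => ω (g 0))) := by rwa [hmap]
    exact this.comp_measurable (measurable_pi_apply _)
  have key := strong_law_ae_real (μ := poissonField ι r) (fun k ω => f (ω (g k))) hint
    (fun i j hij => hindep.indepFun (hg.ne hij))
    (fun i => ⟨(hmeas _).aemeasurable, (hmeas _).aemeasurable, by rw [hmapf, hmapf]⟩)
  have hval : ∫ ω, f (ω (g 0)) ∂poissonField ι r = ∫ x, f x ∂poissonMeasure r := by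
    rw [← hmap (g 0), integral_map (measurable_pi_apply _).aemeasurable
      (measurable_of_countable f).aestronglyMeasurable]
  rwa [hval] at key

/-- The probability that a Poisson(`r`) variable is odd. -/
noncomputable def poissonOdd (r : ℝ) : ℝ := (1 - Real.exp (-2 * r)) / 2

theorem hasSum_poisson_weight_mul_id (r : ℝ≥0) :
    HasSum (fun n : ℕ => Real.exp (-r) * r ^ n / n.factorial * (n : ℝ)) r := by
  have h := (hasSum_one_poissonMeasure r).mul_left (r : ℝ)
  have hshift : (fun n : ℕ => Real.exp (-r) * (r : ℝ) ^ (n + 1) / (n + 1).factorial *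
      ((n + 1 : ℕ) : ℝ)) = fun n : ℕ => (r : ℝ) * (Real.exp (-r) * r ^ n / n.factorial) := by
    funext n
    rw [Nat.factorial_succ]
    push_cast
    field_simp
    ring
  rw [← hasSum_nat_add_iff' 1, hshift]
  simpa using h

theorem integrable_natCast_poissonMeasure (r : ℝ≥0) :
    Integrable (fun n : ℕ => (n : ℝ)) (poissonMeasure r) := by
  rw [integrable_poissonMeasure_iff]
  simpa using (hasSum_poisson_weight_mul_id r).summable

theorem integrable_of_le_natCast {r : ℝ≥0} {f : ℕ → ℝ} (hf : ∀ n, |f n| ≤ n) :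
    Integrable f (poissonMeasure r) :=
  (integrable_natCast_poissonMeasure r).mono' (measurable_of_countable f).aestronglyMeasurable
    (ae_of_all _ hf)

theorem integrable_mod_two (r : ℝ≥0) :
    Integrable (fun n : ℕ => ((n % 2 : ℕ) : ℝ)) (poissonMeasure r) :=
  integrable_of_le_natCast fun n => by
    rw [abs_of_nonneg (by positivity)]; exact_mod_cast Nat.mod_le n 2

theorem integrable_div_two (r : ℝ≥0) :
    Integrable (fun n : ℕ => ((n / 2 : ℕ) : ℝ)) (poissonMeasure r) :=
  integrable_of_le_natCast fun n => by
    rw [abs_of_nonneg (by positivity)]; exact_mod_cast Nat.div_le_self n 2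

theorem integral_natCast_poissonMeasure (r : ℝ≥0) : ∫ n : ℕ, (n : ℝ) ∂poissonMeasure r = r :=
  (hasSum_integral_poissonMeasure (integrable_natCast_poissonMeasure r)).unique
    (by simpa using hasSum_poisson_weight_mul_id r)

theorem integral_neg_one_pow_poissonMeasure (r : ℝ≥0) :
    ∫ n : ℕ, (-1 : ℝ) ^ n ∂poissonMeasure r = Real.exp (-2 * r) := by
  rw [integral_poissonMeasure]
  have h := (NormedSpace.expSeries_div_hasSum_exp (-(r : ℝ))).mul_left (Real.exp (-r))
  rw [← Real.exp_eq_exp_ℝ, ← Real.exp_add] at h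
  rw [show (-2 * (r : ℝ)) = -r + -r by ring, ← h.tsum_eq]
  refine tsum_congr fun n => ?_
  rw [smul_eq_mul, neg_pow (r : ℝ)]
  ring

theorem integral_mod_two_poissonMeasure (r : ℝ≥0) :
    ∫ n : ℕ, ((n % 2 : ℕ) : ℝ) ∂poissonMeasure r = poissonOdd r := by
  have h : ∀ n : ℕ, ((n % 2 : ℕ) : ℝ) = (1 - (-1 : ℝ) ^ n) / 2 := by
    intro n
    rcases Nat.even_or_odd n with h | h
    · simp [h.neg_one_pow, Nat.even_iff.mp h]
    · simp [h.neg_one_pow, Nat.odd_iff.mp h]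
  have hi : Integrable (fun n : ℕ => (-1 : ℝ) ^ n) (poissonMeasure r) :=
    (integrable_const (1 : ℝ)).mono' (measurable_of_countable _).aestronglyMeasurable
      (ae_of_all _ fun n => by simp)
  simp_rw [h]
  rw [integral_div, integral_sub (integrable_const _) hi, integral_neg_one_pow_poissonMeasure]
  simp [poissonOdd]

theorem integral_div_two_poissonMeasure (r : ℝ≥0) :
    ∫ n : ℕ, ((n / 2 : ℕ) : ℝ) ∂poissonMeasure r = (r - poissonOdd r) / 2 := by
  have h : ∀ n : ℕ, ((n / 2 : ℕ) : ℝ) = ((n : ℝ) - ((n % 2 : ℕ) : ℝ)) / 2 := by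
    intro n
    have : (n : ℝ) = 2 * ((n / 2 : ℕ) : ℝ) + ((n % 2 : ℕ) : ℝ) := by
      exact_mod_cast (Nat.div_add_mod n 2).symm
    linarith
  simp_rw [h]
  rw [integral_div, integral_sub (integrable_natCast_poissonMeasure r) (integrable_mod_two r),
    integral_natCast_poissonMeasure, integral_mod_two_poissonMeasure]

/-! ### The critical density -/

/-- Twice the amount by which the mean number of complete pairs of particles in a Poisson(`x`) pile
falls short of the critical value `1`. -/
noncomputable def deficit (x : ℝ) : ℝ := 5 / 2 - 1 / 2 * Real.exp (-2 * x) - x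

theorem hasDerivAt_deficit (x : ℝ) : HasDerivAt deficit (Real.exp (-2 * x) - 1) x := by
  have h1 : HasDerivAt (fun x : ℝ => Real.exp (-2 * x)) (Real.exp (-2 * x) * (-2)) x := by
    simpa using ((hasDerivAt_id x).const_mul (-2)).exp
  have := ((h1.const_mul (1 / 2)).const_sub (5 / 2)).sub (hasDerivAt_id x)
  refine this.congr_deriv ?_
  ring

theorem continuous_deficit : Continuous deficit :=
  continuous_iff_continuousAt.mpr fun x => (hasDerivAt_deficit x).continuousAt

theorem strictAntiOn_deficit : StrictAntiOn deficit (Ici 0) := by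
  refine strictAntiOn_of_deriv_neg (convex_Ici 0) continuous_deficit.continuousOn fun x hx => ?_
  rw [interior_Ici] at hx
  rw [(hasDerivAt_deficit x).deriv, sub_neg, Real.exp_lt_one_iff]
  have : (0 : ℝ) < x := hx
  linarith

/-- The exponential is estimated as `exp (t - 5)` with a small `t`, from the known decimals of
`exp 1` and a first-order bound for `exp t`. -/
theorem deficit_lower_pos : 0 < deficit 2.4966076 := by
  have h5 : (2.7182818283 : ℝ) ^ 5 < Real.exp 5 := by
    rw [show (5 : ℝ) = ((5 : ℕ) : ℝ) * 1 by norm_num, Real.exp_nat_mul]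
    exact pow_lt_pow_left₀ Real.exp_one_gt_d9 (by norm_num) (by norm_num)
  have ht := Real.exp_bound_div_one_sub_of_interval (x := (0.0067848 : ℝ)) (by norm_num)
    (by norm_num)
  have key : Real.exp (-2 * 2.4966076) < 0.0067848 := by
    rw [show (-2 * 2.4966076 : ℝ) = 0.0067848 - 5 by norm_num, Real.exp_sub,
      div_lt_iff₀ (Real.exp_pos 5)]
    calc Real.exp 0.0067848 ≤ 1 / (1 - 0.0067848) := ht
      _ < 0.0067848 * 2.7182818283 ^ 5 := by norm_num
      _ < 0.0067848 * Real.exp 5 := by gcongr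
  unfold deficit
  linarith

theorem deficit_upper_neg : deficit 2.4966084 < 0 := by
  have h5 : Real.exp 5 < (2.7182818286 : ℝ) ^ 5 := by
    rw [show (5 : ℝ) = ((5 : ℕ) : ℝ) * 1 by norm_num, Real.exp_nat_mul]
    exact pow_lt_pow_left₀ Real.exp_one_lt_d9 (Real.exp_pos 1).le (by norm_num)
  have key : 0.0067832 < Real.exp (-2 * 2.4966084) := by
    rw [show (-2 * 2.4966084 : ℝ) = 0.0067832 - 5 by norm_num, Real.exp_sub,
      lt_div_iff₀ (Real.exp_pos 5)]
    calc 0.0067832 * Real.exp 5 < 0.0067832 * 2.7182818286 ^ 5 := by gcongr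
      _ < 0.0067832 + 1 := by norm_num
      _ ≤ Real.exp 0.0067832 := Real.add_one_le_exp _
  unfold deficit
  linarith

theorem exists_deficit_zero : ∃ c : ℝ, 2.4966076 < c ∧ c < 2.4966084 ∧ deficit c = 0 := by
  obtain ⟨c, hc, h0⟩ := intermediate_value_Icc' (a := (2.4966076 : ℝ)) (b := 2.4966084)
    (by norm_num) continuous_deficit.continuousOn ⟨deficit_upper_neg.le, deficit_lower_pos.le⟩
  refine ⟨c, lt_of_le_of_ne hc.1 ?_, lt_of_le_of_ne hc.2 ?_, h0⟩
  · rintro rfl; exact deficit_lower_pos.ne' h0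
  · rintro rfl; exact deficit_upper_neg.ne h0

theorem deficit_pos_of_lt {c x : ℝ} (h0 : deficit c = 0) (hx : 0 ≤ x) (h : x < c) :
    0 < deficit x :=
  h0 ▸ strictAntiOn_deficit (mem_Ici.2 hx) (mem_Ici.2 (hx.trans h.le)) h

theorem deficit_neg_of_lt {c x : ℝ} (h0 : deficit c = 0) (hc : 0 ≤ c) (h : c < x) :
    deficit x < 0 :=
  h0 ▸ strictAntiOn_deficit (mem_Ici.2 hc) (mem_Ici.2 (hc.trans h.le)) h

theorem limitDensity_of_deficit_nonneg {x : ℝ} (h : 0 ≤ deficit x) : limitDensity x = x :=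
  min_eq_left (by unfold deficit at h; linarith)

theorem limitDensity_of_deficit_nonpos {x : ℝ} (h : deficit x ≤ 0) :
    limitDensity x = (5 - Real.exp (-2 * x)) / 2 :=
  min_eq_right (by unfold deficit at h; linarith)

theorem hasDerivAt_supercritical (x : ℝ) :
    HasDerivAt (fun x : ℝ => (5 - Real.exp (-2 * x)) / 2) (Real.exp (-2 * x)) x := by
  have h1 : HasDerivAt (fun x : ℝ => Real.exp (-2 * x)) (Real.exp (-2 * x) * (-2)) x := by
    simpa using ((hasDerivAt_id x).const_mul (-2)).exp
  exact ((h1.const_sub 5).div_const 2).congr_deriv (by ring)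

theorem hasDerivAt_limitDensity_of_deficit_pos {x : ℝ} (h : 0 < deficit x) :
    HasDerivAt limitDensity 1 x := by
  refine (hasDerivAt_id x).congr_of_eventuallyEq ?_
  filter_upwards [continuous_deficit.continuousAt.eventually (lt_mem_nhds h)] with y hy
  exact limitDensity_of_deficit_nonneg hy.le

theorem hasDerivAt_limitDensity_of_deficit_neg {x : ℝ} (h : deficit x < 0) :
    HasDerivAt limitDensity (Real.exp (-2 * x)) x := by
  refine (hasDerivAt_supercritical x).congr_of_eventuallyEq ?_
  filter_upwards [continuous_deficit.continuousAt.eventually (gt_mem_nhds h)] with y hy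
  exact limitDensity_of_deficit_nonpos hy.le

theorem hasSecondOrderTransitionAt_limitDensity {c : ℝ} (hc : 0 < c) (h0 : deficit c = 0) :
    HasSecondOrderTransitionAt limitDensity c := by
  have hleft : ∀ᶠ x in 𝓝[<] c, 0 < deficit x := by
    filter_upwards [self_mem_nhdsWithin, mem_nhdsWithin_of_mem_nhds (Ioi_mem_nhds hc)] with x h1 h2
    exact deficit_pos_of_lt h0 (mem_Ioi.1 h2).le h1
  have hright : ∀ᶠ x in 𝓝[>] c, deficit x < 0 := by
    filter_upwards [self_mem_nhdsWithin] with x h1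
    exact deficit_neg_of_lt h0 hc.le h1
  refine ⟨?_, ?_, 1, Real.exp (-2 * c), ?_, ?_, ?_⟩
  · exact (continuous_id.min (by fun_prop)).continuousAt
  · rw [← Iio_union_Ioi, nhdsWithin_union, eventually_sup]
    exact ⟨hleft.mono fun x h => (hasDerivAt_limitDensity_of_deficit_pos h).differentiableAt,
      hright.mono fun x h => (hasDerivAt_limitDensity_of_deficit_neg h).differentiableAt⟩
  · exact (Real.exp_lt_one_iff.mpr (by linarith)).ne'
  · exact tendsto_const_nhds.congr' (hleft.mono fun x h =>
      (hasDerivAt_limitDensity_of_deficit_pos h).deriv.symm)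
  · have : Tendsto (fun x : ℝ => Real.exp (-2 * x)) (𝓝[>] c) (𝓝 (Real.exp (-2 * c))) :=
      (Continuous.tendsto (by fun_prop) c).mono_left nhdsWithin_le_nhds
    exact this.congr' (hright.mono fun x h =>
      (hasDerivAt_limitDensity_of_deficit_neg h).deriv.symm)

/-! ### Toppling on the infinite bracelet -/

namespace Multigraph

theorem infiniteBracelet_mult (v w : ℤ) : infiniteBracelet.mult v w =
    2 * ((if w = v + 1 then 1 else 0) + (if v = w + 1 then 1 else 0)) := rfl

theorem infiniteBracelet_finsum_mult (p : ℤ → Prop) [DecidablePred p] (w : ℤ) :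
    ∑ᶠ v, (if p v then infiniteBracelet.mult v w else 0) =
      2 * (if p (w - 1) then 1 else 0) + 2 * (if p (w + 1) then 1 else 0) := by
  have hsub : (Function.support fun v => if p v then infiniteBracelet.mult v w else 0) ⊆
      (({w - 1, w + 1} : Finset ℤ) : Set ℤ) := by
    intro v hv
    simp only [Function.mem_support, infiniteBracelet_mult] at hv
    simp only [Finset.coe_insert, Finset.coe_singleton, mem_insert_iff, mem_singleton_iff]
    by_contra h
    push Not at h
    rw [if_neg (fun e : w = v + 1 => h.1 (by omega)), if_neg h.2] at hv
    simp at hv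
  rw [finsum_eq_sum_of_support_subset _ hsub, Finset.sum_pair (by omega)]
  simp only [infiniteBracelet_mult]
  rw [if_pos (show w = w - 1 + 1 by omega), if_neg (show ¬ w - 1 = w + 1 by omega),
    if_neg (show ¬ w = w + 1 + 1 by omega), if_true]
  split_ifs <;> rfl

theorem infiniteBracelet_degree (v : ℤ) : infiniteBracelet.degree v = 4 := by
  have h := infiniteBracelet_finsum_mult (fun _ => True) v
  simp only [if_true] at h
  simp_rw [degree, infiniteBracelet.symm v]
  exact h

theorem infiniteBracelet_parallelStep (η : ℤ → ℕ) (w : ℤ) :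
    infiniteBracelet.parallelStep η w = (if 4 ≤ η w then η w - 4 else η w) +
      (2 * (if 4 ≤ η (w - 1) then 1 else 0) + 2 * (if 4 ≤ η (w + 1) then 1 else 0)) := by
  simp only [parallelStep, infiniteBracelet_degree]
  rw [← infiniteBracelet_finsum_mult (fun v => 4 ≤ η v) w]

/-- The odometer: the number of times `v` topples in the first `N` steps of parallel toppling. -/
noncomputable def odometer (η : ℤ → ℕ) : ℕ → ℤ → ℤ
  | 0, _ => 0
  | N + 1, v => odometer η N v + if 4 ≤ (infiniteBracelet.parallelStep^[N] η) v then 1 else 0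

theorem iterate_parallelStep_eq (η : ℤ → ℕ) (N : ℕ) (v : ℤ) :
    ((infiniteBracelet.parallelStep^[N] η) v : ℤ) = η v +
      2 * (odometer η N (v - 1) + odometer η N (v + 1) - 2 * odometer η N v) := by
  induction N generalizing v with
  | zero => simp [odometer]
  | succ N ih =>
    rw [Function.iterate_succ_apply', infiniteBracelet_parallelStep]
    have h := ih v
    simp only [odometer]
    push_cast
    split_ifs <;> push_cast <;> omega

theorem odometer_mono (η : ℤ → ℕ) (v : ℤ) : Monotone fun N => odometer η N v :=
  monotone_nat_of_le_succ fun N => by simp only [odometer]; split_ifs <;> omega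

theorem odometer_nonneg (η : ℤ → ℕ) (N : ℕ) (v : ℤ) : 0 ≤ odometer η N v :=
  odometer_mono η v (Nat.zero_le N)

/-- If `η` stabilizes, the final odometer is a nonnegative function whose discrete Laplacian
reduces the number of pairs of particles to at most one at every site. -/
theorem Stabilizes.exists_odometer {η : ℤ → ℕ} (h : infiniteBracelet.Stabilizes η) :
    ∃ u : ℤ → ℤ, (∀ v, 0 ≤ u v) ∧
      ∀ v, ((η v / 2 : ℕ) : ℤ) + (u (v - 1) + u (v + 1) - 2 * u v) ≤ 1 := by
  choose N hN using h
  have hconst : ∀ v, ∀ j ≥ N v, odometer η j v = odometer η (N v) v := by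
    intro v j hj
    induction j, hj using Nat.le_induction with
    | base => rfl
    | succ j hj ih =>
      have := hN v j hj
      rw [infiniteBracelet_degree] at this
      simp only [odometer]
      rw [if_neg (by omega), ih, add_zero]
  refine ⟨fun v => odometer η (N v) v, fun v => odometer_nonneg _ _ _, fun v => ?_⟩
  set j := max (N v) (max (N (v - 1)) (N (v + 1))) with hj
  have h1 := hconst v j (by omega)
  have h2 := hconst (v - 1) j (by omega)
  have h3 := hconst (v + 1) j (by omega)
  have h4 := iterate_parallelStep_eq η j v
  have h5 := hN v j (by omega)
  rw [infiniteBracelet_degree] at h5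
  simp only
  omega

/-- The least action principle: a nonnegative function whose Laplacian removes all excess pairs of
particles dominates the odometer, so its existence forces stabilization. -/
theorem stabilizes_of_supersolution {η : ℤ → ℕ} (u : ℤ → ℤ) (h0 : ∀ v, 0 ≤ u v)
    (hu : ∀ v, ((η v / 2 : ℕ) : ℤ) + (u (v - 1) + u (v + 1) - 2 * u v) ≤ 1) :
    infiniteBracelet.Stabilizes η := by
  have hle : ∀ N v, odometer η N v ≤ u v := by
    intro N
    induction N with
    | zero => exact h0
    | succ N ih =>
      intro v
      simp only [odometer]
      have h1 := iterate_parallelStep_eq η N v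
      have h2 := ih v
      have h3 := ih (v - 1)
      have h4 := ih (v + 1)
      have h5 := hu v
      split_ifs <;> omega
  intro v
  -- a bounded monotone integer sequence is eventually constant
  by_contra hcon
  push Not at hcon
  have hgrow : ∀ k : ℕ, ∃ N, (k : ℤ) ≤ odometer η N v := by
    intro k
    induction k with
    | zero => exact ⟨0, by simp [odometer]⟩
    | succ k ih =>
      obtain ⟨N, hN⟩ := ih
      obtain ⟨j, hj, hj'⟩ := hcon N
      rw [infiniteBracelet_degree] at hj'
      refine ⟨j + 1, ?_⟩
      have := odometer_mono η v hj
      simp only [odometer] at this ⊢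
      rw [if_pos hj']
      push_cast
      omega
  obtain ⟨N, hN⟩ := hgrow ((u v).toNat + 1)
  have := hle N v
  push_cast at hN
  omega

/-! ### The threshold density -/

theorem not_stabilizes_of_tendsto {η : ℤ → ℕ} {μ : ℝ} (hμ : 1 < μ)
    (h : Tendsto (fun n : ℕ => (∑ k ∈ Finset.range n, ((η (k : ℤ) / 2 : ℕ) : ℝ)) / n) atTop
      (𝓝 μ)) : ¬ infiniteBracelet.Stabilizes η := by
  intro hs
  obtain ⟨u, h0, hu⟩ := hs.exists_odometer
  have hslope : ∀ n : ℕ, u n - u (n - 1) ≤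
      u 0 - u (-1) + n - ∑ k ∈ Finset.range n, ((η (k : ℤ) / 2 : ℕ) : ℤ) := by
    intro n
    induction n with
    | zero => simp
    | succ n ih =>
      rw [Finset.sum_range_succ]
      have := hu n
      push_cast at this ih ⊢
      rw [add_sub_cancel_right]
      linarith
  have htop : Tendsto (fun n : ℕ => (∑ k ∈ Finset.range n, ((η (k : ℤ) / 2 : ℕ) : ℝ)) - n)
      atTop atTop := by
    have h1 : Tendsto (fun n : ℕ => (n : ℝ) *
        ((∑ k ∈ Finset.range n, ((η (k : ℤ) / 2 : ℕ) : ℝ)) / n - 1)) atTop atTop :=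
      tendsto_natCast_atTop_atTop.atTop_mul_pos (sub_pos.2 hμ) (h.sub_const 1)
    refine h1.congr' ?_
    filter_upwards [eventually_gt_atTop 0] with n hn
    have : (n : ℝ) ≠ 0 := by positivity
    field_simp
  obtain ⟨M, hM⟩ := eventually_atTop.1 (htop.eventually_ge_atTop (u 0 - u (-1) + 1 : ℝ))
  have hdec : ∀ n ≥ M, u n ≤ u (n - 1) - 1 := by
    intro n hn
    have h1 := hM n hn
    have h2 : (u 0 - u (-1) + 1 : ℤ) ≤
        (∑ k ∈ Finset.range n, ((η (k : ℤ) / 2 : ℕ) : ℤ)) - n := by exact_mod_cast h1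
    have := hslope n
    linarith
  have hlin : ∀ j : ℕ, u (M + j) ≤ u M - j := by
    intro j
    induction j with
    | zero => simp
    | succ j ih =>
      have := hdec (M + (j + 1)) (by omega)
      push_cast at this ⊢
      rw [show (M + (j + 1) - 1 : ℤ) = M + j by ring] at this
      linarith
  have h1 := hlin ((u M).toNat + 1)
  have h2 := h0 (M + ((u M).toNat + 1 : ℕ))
  have h3 := h0 M
  push_cast at h1 h2
  omega

theorem bddBelow_doubleSum {f : ℕ → ℤ}
    (h : ∀ᶠ j : ℕ in atTop, 0 ≤ ∑ k ∈ Finset.range j, f k) :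
    ∃ B : ℤ, ∀ n, B ≤ ∑ j ∈ Finset.range n, ∑ k ∈ Finset.range (j + 1), f k := by
  obtain ⟨M, hM⟩ := eventually_atTop.1 h
  obtain ⟨B, hB⟩ := ((finite_Iic M).image
    fun n => ∑ j ∈ Finset.range n, ∑ k ∈ Finset.range (j + 1), f k).bddBelow
  refine ⟨B, fun n => ?_⟩
  rcases le_total n M with hn | hn
  · exact hB (mem_image_of_mem _ hn)
  · induction n, hn using Nat.le_induction with
    | base => exact hB (mem_image_of_mem _ (mem_Iic.2 le_rfl))
    | succ n hn ih =>
      rw [Finset.sum_range_succ]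
      have := hM (n + 1) (by omega)
      omega

/-- If the partial sums of `f` are nonnegative far out in both directions, then `f` is the
Laplacian of a nonnegative function. -/
theorem exists_nonneg_laplacian_eq (f : ℤ → ℤ)
    (hr : ∀ᶠ j : ℕ in atTop, 0 ≤ ∑ k ∈ Finset.range j, f k)
    (hl : ∀ᶠ j : ℕ in atTop, 0 ≤ ∑ k ∈ Finset.range j, f (Int.negSucc k)) :
    ∃ u : ℤ → ℤ, (∀ v, 0 ≤ u v) ∧ ∀ v, u (v - 1) + u (v + 1) - 2 * u v = f v := by
  obtain ⟨A, hA⟩ := bddBelow_doubleSum hr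
  obtain ⟨B, hB⟩ := bddBelow_doubleSum (f := fun k => f (Int.negSucc k)) hl
  set R : ℕ → ℤ := fun n => ∑ j ∈ Finset.range n, ∑ k ∈ Finset.range (j + 1), f k with hR
  set L : ℕ → ℤ := fun n => ∑ j ∈ Finset.range n, ∑ k ∈ Finset.range (j + 1), f (Int.negSucc k)
    with hL
  -- `u` has slope `0` between `-1` and `0`; `|A| + |B|` makes it nonnegative
  refine ⟨fun v => |A| + |B| + Int.rec R L v, fun v => ?_, fun v => ?_⟩
  · rcases v with n | n
    · have := hA n
      have := neg_abs_le A
      have := abs_nonneg B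
      change 0 ≤ |A| + |B| + R n
      linarith
    · have := hB n
      have := neg_abs_le B
      have := abs_nonneg A
      change 0 ≤ |A| + |B| + L n
      linarith
  · have hR1 : ∀ n, R (n + 1) = R n + ∑ k ∈ Finset.range (n + 1), f k := fun n =>
      Finset.sum_range_succ _ _
    have hL1 : ∀ n, L (n + 1) = L n + ∑ k ∈ Finset.range (n + 1), f (Int.negSucc k) := fun n =>
      Finset.sum_range_succ _ _
    have hR0 : R 0 = 0 := rfl
    have hL0 : L 0 = 0 := rfl
    rcases v with (_ | n) | (_ | n)
    · change |A| + |B| + L 0 + (|A| + |B| + R 1) - 2 * (|A| + |B| + R 0) = f 0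
      rw [hR1 0, hR0, hL0, Finset.sum_range_one]
      push_cast
      ring
    · have e1 : (Int.ofNat (n + 1) - 1 : ℤ) = Int.ofNat n := by simp
      rw [e1]
      change |A| + |B| + R n + (|A| + |B| + R (n + 1 + 1)) - 2 * (|A| + |B| + R (n + 1)) =
        f (n + 1 : ℕ)
      rw [hR1 (n + 1), hR1 n, Finset.sum_range_succ _ (n + 1)]
      ring
    · change |A| + |B| + L 1 + (|A| + |B| + R 0) - 2 * (|A| + |B| + L 0) = f (Int.negSucc 0)
      rw [hL1 0, hR0, hL0, Finset.sum_range_one]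
      ring
    · have e1 : (Int.negSucc (n + 1) - 1 : ℤ) = Int.negSucc (n + 2) := by omega
      have e2 : (Int.negSucc (n + 1) + 1 : ℤ) = Int.negSucc n := by omega
      rw [e1, e2]
      change |A| + |B| + L (n + 1 + 1) + (|A| + |B| + L n) - 2 * (|A| + |B| + L (n + 1)) =
        f (Int.negSucc (n + 1))
      rw [hL1 (n + 1), hL1 n, Finset.sum_range_succ _ (n + 1)]
      ring

theorem eventually_sum_one_sub_nonneg {h : ℕ → ℕ} {μ : ℝ} (hμ : μ < 1)
    (hh : Tendsto (fun n : ℕ => (∑ k ∈ Finset.range n, (h k : ℝ)) / n) atTop (𝓝 μ)) :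
    ∀ᶠ j : ℕ in atTop, 0 ≤ ∑ k ∈ Finset.range j, (1 - (h k : ℤ)) := by
  filter_upwards [hh.eventually (gt_mem_nhds hμ), eventually_gt_atTop 0] with n hn hn0
  rw [div_lt_one (by exact_mod_cast hn0)] at hn
  have : (∑ k ∈ Finset.range n, (h k : ℤ)) < n := by exact_mod_cast hn
  rw [Finset.sum_sub_distrib]
  simp only [Finset.sum_const, Finset.card_range, nsmul_eq_mul, mul_one]
  omega

theorem stabilizes_of_tendsto {η : ℤ → ℕ} {μ : ℝ} (hμ : μ < 1)
    (hr : Tendsto (fun n : ℕ => (∑ k ∈ Finset.range n, ((η (k : ℤ) / 2 : ℕ) : ℝ)) / n) atTop (𝓝 μ))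
    (hl : Tendsto (fun n : ℕ => (∑ k ∈ Finset.range n, ((η (Int.negSucc k) / 2 : ℕ) : ℝ)) / n) atTop
      (𝓝 μ)) : infiniteBracelet.Stabilizes η := by
  obtain ⟨u, h0, hu⟩ := exists_nonneg_laplacian_eq (fun v => 1 - ((η v / 2 : ℕ) : ℤ))
    (eventually_sum_one_sub_nonneg (h := fun k => η (k : ℤ) / 2) hμ hr)
    (eventually_sum_one_sub_nonneg (h := fun k => η (Int.negSucc k) / 2) hμ hl)
  exact stabilizes_of_supersolution u h0 fun v => by rw [hu v]; simp

theorem isThresholdDensity_infiniteBracelet {c : ℝ} (hc : 0 ≤ c) (h0 : deficit c = 0) :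
    infiniteBracelet.IsThresholdDensity c := by
  have hdef : ∀ x, deficit x = 2 * (1 - (x - poissonOdd x) / 2) := fun x => by
    unfold deficit poissonOdd; ring
  refine ⟨hc, fun r => ⟨fun hr => ?_, fun hr => ?_⟩⟩
  · have hμ : ((r : ℝ) - poissonOdd r) / 2 < 1 := by
      have := deficit_pos_of_lt h0 r.coe_nonneg hr
      rw [hdef] at this
      linarith
    have h1 := poissonField_ae_tendsto_average r (g := fun k : ℕ => (k : ℤ)) Nat.cast_injective
      (integrable_div_two r)
    have h2 := poissonField_ae_tendsto_average r (g := Int.negSucc)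
      (fun _ _ h => Int.negSucc.inj h) (integrable_div_two r)
    rw [integral_div_two_poissonMeasure] at h1 h2
    filter_upwards [h1, h2] with σ h1 h2
    exact stabilizes_of_tendsto hμ h1 h2
  · have hμ : 1 < ((r : ℝ) - poissonOdd r) / 2 := by
      have := deficit_neg_of_lt h0 hc hr
      rw [hdef] at this
      linarith
    have h1 := poissonField_ae_tendsto_average r (g := fun k : ℕ => (k : ℤ)) Nat.cast_injective
      (integrable_div_two r)
    rw [integral_div_two_poissonMeasure] at h1
    filter_upwards [h1] with σ h1
    exact not_stabilizes_of_tendsto hμ h1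

end Multigraph

/-! ### Chip moves on an interval of the line -/

/-- `IntervalTopple m x h h'` says that on the sites `0, …, m - 1` the heights `h'` arise from `h`
by moving one unit from `x` to each neighbour; units leaving the interval are lost. -/
structure IntervalTopple (m x : ℕ) (h h' : ℕ → ℕ) : Prop where
  lt : x < m
  two_le : 2 ≤ h x
  eq : ∀ k < m, h' k = (if k = x then h k - 2 else h k) +
    ((if k = x + 1 then 1 else 0) + (if x = k + 1 then 1 else 0))

theorem IntervalTopple.sum_add {m x : ℕ} {h h' : ℕ → ℕ} (H : IntervalTopple m x h h') {i j : ℕ}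
    (hj : j ≤ m) : ∑ k ∈ Finset.Ico i j, h' k + (if i ≤ x ∧ x < j then 2 else 0) =
      ∑ k ∈ Finset.Ico i j, h k + (if i ≤ x + 1 ∧ x + 1 < j then 1 else 0) +
        (if i + 1 ≤ x ∧ x < j + 1 then 1 else 0) := by
  have h1 : ∀ k ∈ Finset.Ico i j, h' k + (if x = k then 2 else 0) =
      h k + (if x + 1 = k then 1 else 0) + (if x = k + 1 then 1 else 0) := by
    intro k hk
    rw [Finset.mem_Ico] at hk
    rw [H.eq k (by omega)]
    have := H.two_le
    by_cases e : x = k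
    · subst e; simp only [if_true]; split_ifs <;> omega
    · rw [if_neg e, if_neg (fun e' => e e'.symm)]; split_ifs <;> omega
  have h2 := Finset.sum_congr rfl h1
  simp only [Finset.sum_add_distrib, Finset.sum_ite_eq, Finset.mem_Ico] at h2
  have h3 : ∑ k ∈ Finset.Ico i j, (if x = k + 1 then 1 else 0) =
      if i + 1 ≤ x ∧ x < j + 1 then 1 else 0 := by
    rw [Finset.sum_Ico_add' (fun k => if x = k then 1 else 0) i j 1, Finset.sum_ite_eq]
    simp only [Finset.mem_Ico]
  rw [h3] at h2
  exact h2

/-- On every interval contained in `U`, the heights fall short of one per site by at most one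
unit. -/
def PackedOn (m : ℕ) (U : Set ℕ) (h : ℕ → ℕ) : Prop :=
  ∀ i j, i ≤ j → j ≤ m → (∀ k, i ≤ k → k < j → k ∈ U) → j ≤ i + ∑ k ∈ Finset.Ico i j, h k + 1

theorem packedOn_empty (m : ℕ) (h : ℕ → ℕ) : PackedOn m ∅ h := by
  intro i j hij hj hU
  rcases hij.eq_or_lt with rfl | hlt
  · omega
  · exact (hU i le_rfl hlt).elim

/-- Toppling `x` adds `x` to the set on which the heights are packed: if an interval contains `x`,
the two units that leave `x` stay in the interval, except at an endpoint `x`, where one of the two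
subintervals to be packed is empty. -/
theorem PackedOn.insert {m x : ℕ} {U : Set ℕ} {h h' : ℕ → ℕ} (hp : PackedOn m U h)
    (H : IntervalTopple m x h h') : PackedOn m (insert x U) h' := by
  intro i j hij hj hU
  have hs := H.sum_add (i := i) hj
  by_cases hx : i ≤ x ∧ x < j
  · have hl := hp i x hx.1 (by omega) fun k h1 h2 =>
      (hU k h1 (by omega)).resolve_left (by omega)
    have hr := hp (x + 1) j hx.2 hj fun k h1 h2 =>
      (hU k (by omega) h2).resolve_left (by omega)
    have hsplit := Finset.sum_Ico_consecutive h hx.1 hx.2.le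
    rw [Finset.sum_eq_sum_Ico_succ_bot hx.2] at hsplit
    have := H.two_le
    rw [if_pos hx] at hs
    split_ifs at hs <;> omega
  · rw [if_neg hx] at hs
    have := hp i j hij hj fun k h1 h2 => (hU k h1 h2).resolve_left (by rintro rfl; exact hx ⟨h1, h2⟩)
    omega

/-- Between two sites outside `U` the total height has not decreased from `h₀` to `h`. -/
def GainsOff (m : ℕ) (U : Set ℕ) (h₀ h : ℕ → ℕ) : Prop :=
  ∀ i j, i ≤ j → j < m → i ∉ U → j ∉ U →
    ∑ k ∈ Finset.Ico i (j + 1), h₀ k ≤ ∑ k ∈ Finset.Ico i (j + 1), h k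

theorem GainsOff.insert {m x : ℕ} {U : Set ℕ} {h₀ h h' : ℕ → ℕ} (hg : GainsOff m U h₀ h)
    (H : IntervalTopple m x h h') : GainsOff m (insert x U) h₀ h' := by
  intro i j hij hj hi hj'
  simp only [mem_insert_iff, not_or] at hi hj'
  have h1 := hg i j hij hj hi.2 hj'.2
  have hs := H.sum_add (i := i) (j := j + 1) hj
  have := hi.1
  have := hj'.1
  split_ifs at hs <;> omega

/-- If `h₀` has density at least `c ≤ 1` on every interval, up to an error `δ`, then so does `h` on
the whole: the first and the last stretch of sites in `U` are packed, and between the first and the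
last site outside `U` the total of `h` is at least that of `h₀`. -/
theorem le_sum_of_packedOn_of_gainsOff {m : ℕ} {U : Set ℕ} {h₀ h : ℕ → ℕ} (hp : PackedOn m U h)
    (hg : GainsOff m U h₀ h) {c δ : ℝ} (hc : c ≤ 1)
    (hδ : ∀ i j, i ≤ j → j ≤ m → c * ((j : ℝ) - i) - δ ≤ ∑ k ∈ Finset.Ico i j, (h₀ k : ℝ)) :
    c * m - 2 - δ ≤ ∑ k ∈ Finset.range m, (h k : ℝ) := by
  classical
  have hδ0 : 0 ≤ δ := by simpa using hδ 0 0 le_rfl (Nat.zero_le m)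
  have hbound : ∀ i j : ℕ, i ≤ j → c * ((j : ℝ) - i) ≤ (j : ℝ) - i := fun i j hij => by
    have : (0 : ℝ) ≤ (j : ℝ) - i := by rw [sub_nonneg]; exact_mod_cast hij
    nlinarith
  have hpr : ∀ i j, i ≤ j → j ≤ m → (∀ k, i ≤ k → k < j → k ∈ U) →
      c * ((j : ℝ) - i) - 1 ≤ ∑ k ∈ Finset.Ico i j, (h k : ℝ) := by
    intro i j hij hj hU
    have h1 : (j : ℝ) ≤ i + ∑ k ∈ Finset.Ico i j, (h k : ℝ) + 1 := by
      exact_mod_cast hp i j hij hj hU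
    linarith [hbound i j hij]
  rw [Finset.range_eq_Ico]
  by_cases hall : ∀ k < m, k ∈ U
  · have := hpr 0 m (Nat.zero_le m) le_rfl fun k _ hk => hall k hk
    simp only [Nat.cast_zero, sub_zero] at this
    linarith
  · push Not at hall
    set T : Finset ℕ := (Finset.range m).filter (· ∉ U) with hT
    have hne : T.Nonempty := by
      obtain ⟨k, hk, hkU⟩ := hall
      exact ⟨k, by simp [hT, hk, hkU]⟩
    have hb := T.min'_mem hne
    have ha := T.max'_mem hne
    have hba := T.min'_le _ ha
    have hlow : ∀ k < T.min' hne, k < m → k ∈ U := fun k hk hkm => by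
      by_contra hkU
      exact absurd (T.min'_le k (by simp [hT, hkm, hkU])) (by omega)
    have hup : ∀ k, T.max' hne < k → k < m → k ∈ U := fun k hk hkm => by
      by_contra hkU
      exact absurd (T.le_max' k (by simp [hT, hkm, hkU])) (by omega)
    generalize T.min' hne = b at *
    generalize T.max' hne = a at *
    simp only [hT, Finset.mem_filter, Finset.mem_range] at ha hb
    have h1 := hpr 0 b (Nat.zero_le b) hb.1.le fun k _ hk => hlow k hk (by omega)
    have h2 := hpr (a + 1) m ha.1 le_rfl fun k hk hk' => hup k (by omega) hk'
    have h3 := hδ b (a + 1) (by omega) ha.1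
    have h4 : ∑ k ∈ Finset.Ico b (a + 1), (h₀ k : ℝ) ≤ ∑ k ∈ Finset.Ico b (a + 1), (h k : ℝ) := by
      exact_mod_cast hg b a hba ha.1 hb.2 ha.2
    rw [← Finset.sum_Ico_consecutive _ (Nat.zero_le b) hb.1.le,
      ← Finset.sum_Ico_consecutive _ (show b ≤ a + 1 by omega) ha.1]
    push_cast at h1 h2 h3
    linarith

/-! ### Sandpiles on a doubled path with sinks at both ends -/

namespace Multigraph

variable {V : Type*} {G : Multigraph V} {S : Set V} {m : ℕ}

/-- The enumeration `e` exhibits the non-sink vertices of `G` as a path of length `m` with doubled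
edges, all of degree `4`; thus each of the two end vertices has two edges to sinks. -/
structure IsDoubledPath (G : Multigraph V) {S : Set V} {m : ℕ} (e : {v : V // v ∉ S} ≃ Fin m) :
    Prop where
  degree_eq : ∀ v : {v : V // v ∉ S}, G.degree v = 4
  mult_eq : ∀ v w : {v : V // v ∉ S}, G.mult v w =
    2 * ((if (e w : ℕ) = e v + 1 then 1 else 0) + (if (e v : ℕ) = e w + 1 then 1 else 0))

/-- The particle numbers of `η` along the path, extended by `0`. -/
def profile (e : {v : V // v ∉ S} ≃ Fin m) (η : Sandpile S) (k : ℕ) : ℕ :=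
  if hk : k < m then η (e.symm ⟨k, hk⟩) else 0

variable {e : {v : V // v ∉ S} ≃ Fin m}

@[simp] theorem profile_apply (η : Sandpile S) (v : {v : V // v ∉ S}) :
    profile e η (e v) = η v := by
  simp [profile]

theorem profile_of_lt (η : Sandpile S) {k : ℕ} (hk : k < m) :
    profile e η k = η (e.symm ⟨k, hk⟩) := dif_pos hk

theorem forall_profile_iff {p : ℕ → ℕ → Prop} {η : Sandpile S} :
    (∀ k < m, p k (profile e η k)) ↔ ∀ v, p (e v) (η v) := by
  refine ⟨fun h v => by simpa using h (e v) (e v).2, fun h k hk => ?_⟩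
  have := h (e.symm ⟨k, hk⟩)
  rwa [Equiv.apply_symm_apply, ← profile_of_lt η hk] at this

theorem profile_ext {η η' : Sandpile S} (h : ∀ k < m, profile e η k = profile e η' k) :
    η = η' := by
  funext v
  simpa using h (e v) (e v).2

theorem density_eq_sum_profile (e : {v : V // v ∉ S} ≃ Fin m) (η : Sandpile S) :
    density η = (∑ k ∈ Finset.range m, (profile e η k : ℝ)) / m := by
  have h1 : ∑ᶠ v, (η v : ℝ) = ∑ᶠ i : Fin m, (profile e η i : ℝ) :=
    finsum_eq_of_bijective e e.bijective fun v => by simp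
  rw [density, h1, finsum_eq_sum_of_fintype,
    Fin.sum_univ_eq_sum_range (fun k => (profile e η k : ℝ)), Nat.card_congr e, Nat.card_fin]

namespace IsDoubledPath

variable (hG : G.IsDoubledPath e)
include hG

theorem isStable_iff {η : Sandpile S} : G.IsStable η ↔ ∀ k < m, profile e η k < 4 := by
  rw [forall_profile_iff (p := fun _ a => a < 4)]
  simp only [IsStable, hG.degree_eq]

theorem profile_topple (η : Sandpile S) (v : {v : V // v ∉ S}) {k : ℕ} (hk : k < m) :
    profile e (G.topple η v) k = (if k = e v then profile e η k - 4 else profile e η k) +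
      2 * ((if k = e v + 1 then 1 else 0) + (if (e v : ℕ) = k + 1 then 1 else 0)) := by
  have hiff : e.symm ⟨k, hk⟩ = v ↔ k = e v := by
    rw [Equiv.symm_apply_eq, Fin.ext_iff]
  simp only [profile_of_lt _ hk, topple, hG.degree_eq, hG.mult_eq, Equiv.apply_symm_apply, hiff]

theorem intervalTopple (η : Sandpile S) {v : {v : V // v ∉ S}} (hv : 4 ≤ η v) :
    IntervalTopple m (e v) (fun k => profile e η k / 2)
      (fun k => profile e (G.topple η v) k / 2) where
  lt := (e v).2
  two_le := by simp only [profile_apply]; omega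
  eq k hk := by
    rw [hG.profile_topple η v hk]
    split_ifs <;> omega

theorem profile_topple_mod_two (η : Sandpile S) {v : {v : V // v ∉ S}} (hv : 4 ≤ η v) {k : ℕ}
    (hk : k < m) : profile e (G.topple η v) k % 2 = profile e η k % 2 := by
  rw [hG.profile_topple η v hk]
  by_cases h : k = e v
  · have : profile e η k = η v := by rw [h, profile_apply]
    rw [if_pos h]; omega
  · rw [if_neg h]; omega

/-- The effect of a toppling on a linear functional of the sandpile is the discrete Laplacian of its
coefficients, provided these vanish (up to `2`-torsion) at the two sinks. -/
theorem sum_mul_profile_topple {R : Type*} [CommRing R] (F : ℕ → R) (hF0 : 2 * F 0 = 0)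
    (hFm : 2 * F (m + 1) = 0) (η : Sandpile S) {v : {v : V // v ∉ S}} (hv : 4 ≤ η v) :
    ∑ k ∈ Finset.range m, F (k + 1) * (profile e (G.topple η v) k : R) =
      ∑ k ∈ Finset.range m, F (k + 1) * (profile e η k : R) +
        (2 * F (e v) + 2 * F (e v + 2) - 4 * F (e v + 1)) := by
  set x : ℕ := (e v : ℕ) with hx
  have hxm : x < m := (e v).2
  have hterm : ∀ k ∈ Finset.range m, F (k + 1) * (profile e (G.topple η v) k : R) =
      F (k + 1) * (profile e η k : R) - (if x = k then 4 * F (k + 1) else 0) +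
      ((if x + 1 = k then 2 * F (k + 1) else 0) + (if x = k + 1 then 2 * F (k + 1) else 0)) := by
    intro k hk
    rw [hG.profile_topple η v (Finset.mem_range.1 hk), ← hx]
    by_cases h : x = k
    · have h4 : 4 ≤ profile e η k := by rw [← h, hx, profile_apply]; exact hv
      rw [if_pos h, if_pos h.symm, if_neg (by omega), if_neg (by omega), if_neg (by omega),
        if_neg (by omega)]
      push_cast [Nat.cast_sub h4]
      ring
    · rw [if_neg h, if_neg (fun e' => h e'.symm)]
      by_cases h1 : x + 1 = k
      · rw [if_pos h1, if_pos h1.symm, if_neg (by omega), if_neg (by omega)]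
        push_cast
        ring
      · rw [if_neg h1, if_neg (fun e' => h1 e'.symm)]
        split_ifs <;> push_cast <;> ring
  rw [Finset.sum_congr rfl hterm, Finset.sum_add_distrib, Finset.sum_sub_distrib,
    Finset.sum_add_distrib, Finset.sum_ite_eq, Finset.sum_ite_eq,
    if_pos (Finset.mem_range.2 hxm)]
  have hright : (if x + 1 ∈ Finset.range m then 2 * F (x + 1 + 1) else 0) = 2 * F (x + 2) := by
    split_ifs with h
    · rfl
    · rw [Finset.mem_range] at h
      rw [show x + 2 = m + 1 by omega, hFm]
  have hleft : ∑ k ∈ Finset.range m, (if x = k + 1 then 2 * F (k + 1) else 0) = 2 * F x := by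
    rcases Nat.eq_zero_or_pos x with h | h
    · rw [h, hF0]
      exact Finset.sum_eq_zero fun k _ => if_neg (by omega)
    · rw [Finset.sum_eq_single_of_mem (x - 1) (Finset.mem_range.2 (by omega)) fun k _ hk =>
        if_neg (by omega), if_pos (by omega), show x - 1 + 1 = x by omega]
  rw [hright, hleft]
  ring

/-- Every sandpile on a doubled path has a stabilization: the strictly concave potential
`∑ k (m + 1 - k) η_k` drops with each toppling. -/
theorem exists_isStabilization (η : Sandpile S) : ∃ η', G.IsStabilization η η' := by
  set F : ℕ → ℤ := fun k => k * (m + 1 - k) with hF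
  have hnonneg : ∀ η : Sandpile S, 0 ≤ ∑ k ∈ Finset.range m, F (k + 1) * (profile e η k : ℤ) := by
    intro η
    refine Finset.sum_nonneg fun k hk => mul_nonneg ?_ (by positivity)
    rw [Finset.mem_range] at hk
    exact mul_nonneg (by positivity) (by push_cast; omega)
  have key : ∀ n : ℕ, ∀ η : Sandpile S,
      ∑ k ∈ Finset.range m, F (k + 1) * (profile e η k : ℤ) ≤ n →
      ∃ η', G.IsStabilization η η' := by
    intro n
    induction n with
    | zero =>
      intro η hη
      by_cases hs : G.IsStable η
      · exact ⟨η, Relation.ReflTransGen.refl, hs⟩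
      · simp only [IsStable, not_forall, not_lt, hG.degree_eq] at hs
        obtain ⟨v, hv⟩ := hs
        have h1 := hG.sum_mul_profile_topple F (by simp [hF]) (by simp [hF]) η hv
        have h2 := hnonneg (G.topple η v)
        have h3 : 2 * F (e v) + 2 * F (e v + 2) - 4 * F (e v + 1) = -4 := by
          simp only [hF]; push_cast; ring
        push_cast at hη
        omega
    | succ n ih =>
      intro η hη
      by_cases hs : G.IsStable η
      · exact ⟨η, Relation.ReflTransGen.refl, hs⟩
      · simp only [IsStable, not_forall, not_lt, hG.degree_eq] at hs
        obtain ⟨v, hv⟩ := hs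
        have h1 := hG.sum_mul_profile_topple F (by simp [hF]) (by simp [hF]) η hv
        have h3 : 2 * F (e v) + 2 * F (e v + 2) - 4 * F (e v + 1) = -4 := by
          simp only [hF]; push_cast; ring
        push_cast at hη
        obtain ⟨η', h4, h5⟩ := ih (G.topple η v) (by omega)
        exact ⟨η', Relation.ReflTransGen.head ⟨v, by rwa [hG.degree_eq], rfl⟩ h4, h5⟩
  exact key _ η (Int.self_le_toNat _)

theorem isStabilization_stabilization (η : Sandpile S) :
    G.IsStabilization η (G.stabilization η) := by
  have h := hG.exists_isStabilization η
  rw [stabilization, dif_pos h]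
  exact h.choose_spec

/-- A property of sandpiles that is preserved by legal topplings passes to the stabilization. -/
theorem stabilization_induction {P : Sandpile S → Prop} {η : Sandpile S} (h0 : P η)
    (hstep : ∀ (η' : Sandpile S) (v : {v : V // v ∉ S}), P η' → 4 ≤ η' v → P (G.topple η' v)) :
    P (G.stabilization η) := by
  have h := (hG.isStabilization_stabilization η).1
  generalize G.stabilization η = ξ at h
  induction h with
  | refl => exact h0
  | tail _ hab ih =>
    obtain ⟨v, hv, rfl⟩ := hab
    rw [hG.degree_eq] at hv
    exact hstep _ v ih hv

theorem profile_stabilization_lt (η : Sandpile S) {k : ℕ} (hk : k < m) :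
    profile e (G.stabilization η) k < 4 :=
  hG.isStable_iff.1 (hG.isStabilization_stabilization η).2 k hk

theorem profile_stabilization_mod_two (η : Sandpile S) {k : ℕ} (hk : k < m) :
    profile e (G.stabilization η) k % 2 = profile e η k % 2 :=
  hG.stabilization_induction (P := fun η' => profile e η' k % 2 = profile e η k % 2) rfl
    fun η' _ h hv => (hG.profile_topple_mod_two η' hv hk).trans h

/-- Stabilizing does not increase the number of complete pairs of particles. -/
theorem sum_pairs_stabilization_le (η : Sandpile S) :
    ∑ k ∈ Finset.range m, profile e (G.stabilization η) k / 2 ≤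
      ∑ k ∈ Finset.range m, profile e η k / 2 := by
  refine hG.stabilization_induction (P := fun η' => ∑ k ∈ Finset.range m, profile e η' k / 2 ≤
    ∑ k ∈ Finset.range m, profile e η k / 2) le_rfl fun η' v h hv => ?_
  refine le_trans ?_ h
  have hs := (hG.intervalTopple η' hv).sum_add (i := 0) (j := m) le_rfl
  have := (e v).2
  rw [Finset.range_eq_Ico]
  rw [if_pos ⟨Nat.zero_le _, this⟩] at hs
  split_ifs at hs <;> omega

/-- A sandpile in which every interval holds about at least `c ≤ 1` pairs per site keeps about `c`
pairs per site. The set `U` of sites that have toppled and the two invariants of the toppling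
process relative to `U` give the bound. -/
theorem le_sum_pairs_stabilization (η : Sandpile S) {c δ : ℝ} (hc : c ≤ 1)
    (hδ : ∀ i j, i ≤ j → j ≤ m →
      c * ((j : ℝ) - i) - δ ≤ ∑ k ∈ Finset.Ico i j, ((profile e η k / 2 : ℕ) : ℝ)) :
    c * m - 2 - δ ≤ ∑ k ∈ Finset.range m, ((profile e (G.stabilization η) k / 2 : ℕ) : ℝ) := by
  obtain ⟨U, h1, h2⟩ := hG.stabilization_induction (η := η) (P := fun η' => ∃ U : Set ℕ,
    PackedOn m U (fun k => profile e η' k / 2) ∧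
      GainsOff m U (fun k => profile e η k / 2) (fun k => profile e η' k / 2))
    ⟨∅, packedOn_empty _ _, fun _ _ _ _ _ _ => le_rfl⟩
    fun η' v ⟨U, h1, h2⟩ hv => ⟨insert (e v : ℕ) U, h1.insert (hG.intervalTopple η' hv),
      h2.insert (hG.intervalTopple η' hv)⟩
  exact le_sum_of_packedOn_of_gainsOff h1 h2 hc hδ

end IsDoubledPath

end Multigraph

/-! ### Recurrent sandpiles on a doubled path -/

namespace Multigraph

variable {V : Type*} {G : Multigraph V} {S : Set V} {m : ℕ}
  {e : {v : V // v ∉ S} ≃ Fin m}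

/-- Every interval of the path lacks at most one pair of particles. For a stable sandpile this says
that at most one site holds no pair. -/
def IsPacked (e : {v : V // v ∉ S} ≃ Fin m) (η : Sandpile S) : Prop :=
  PackedOn m univ fun k => profile e η k / 2

/-- The quantity `∑ (k + 1) η_k` modulo `2 (m + 1)`, which is unchanged by toppling. -/
noncomputable def moment (e : {v : V // v ∉ S} ≃ Fin m) (η : Sandpile S) : ZMod (2 * (m + 1)) :=
  ∑ k ∈ Finset.range m, ((k + 1 : ℕ) : ZMod (2 * (m + 1))) * (profile e η k : ZMod (2 * (m + 1)))

/-- Sandpiles with equal toppling invariants: the parities and the moment. -/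
def SameClass (e : {v : V // v ∉ S} ≃ Fin m) (η η' : Sandpile S) : Prop :=
  (∀ k < m, profile e η k % 2 = profile e η' k % 2) ∧ moment e η = moment e η'

/-- Packed heights at most one equal one everywhere, except at a single site `p - 1` of height zero;
`p = 0` stands for the absence of such a site. -/
theorem exists_gap_of_packed {h : ℕ → ℕ} (hp : PackedOn m univ h) (hs : ∀ k < m, h k ≤ 1) :
    ∃ p ≤ m, ∀ k < m, h k = if k + 1 = p then 0 else 1 := by
  by_cases hall : ∀ k < m, h k = 1
  · exact ⟨0, Nat.zero_le m, fun k hk => by rw [hall k hk, if_neg (by omega)]⟩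
  · push Not at hall
    obtain ⟨i, hi, hi1⟩ := hall
    have hi0 : h i = 0 := by have := hs i hi; omega
    have huniq : ∀ a b, a < b → b < m → h a = 0 → h b = 0 → False := by
      intro a b hab hb ha0 hb0
      have h1 := hp a (b + 1) (by omega) hb fun _ _ _ => mem_univ _
      rw [Finset.sum_Ico_succ_top hab.le, hb0, Finset.sum_eq_sum_Ico_succ_bot hab, ha0] at h1
      have h2 : ∑ k ∈ Finset.Ico (a + 1) b, h k ≤ (Finset.Ico (a + 1) b).card * 1 :=
        Finset.sum_le_card_nsmul _ _ _ fun k hk => hs k (by rw [Finset.mem_Ico] at hk; omega)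
      rw [Nat.card_Ico] at h2
      omega
    refine ⟨i + 1, hi, fun k hk => ?_⟩
    rcases lt_trichotomy k i with hlt | rfl | hlt
    · rw [if_neg (by omega)]
      have := hs k hk
      have hne : h k ≠ 0 := fun h0 => huniq k i hlt hi h0 hi0
      omega
    · rw [if_pos rfl, hi0]
    · rw [if_neg (by omega)]
      have := hs k hk
      have hne : h k ≠ 0 := huniq i k hlt hk hi0
      omega

theorem packedOn_of_gap {h : ℕ → ℕ} {p : ℕ}
    (hh : ∀ k < m, h k = if k + 1 = p then 0 else 1) : PackedOn m univ h := by
  intro i j hij hj _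
  have h1 : ∀ k ∈ Finset.Ico i j, h k + (if p = k + 1 then 1 else 0) = 1 := by
    intro k hk
    rw [Finset.mem_Ico] at hk
    rw [hh k (by omega)]
    split_ifs <;> omega
  have h2 := Finset.sum_congr rfl h1
  rw [Finset.sum_add_distrib,
    Finset.sum_Ico_add' (fun k => if p = k then 1 else 0) i j 1, Finset.sum_ite_eq] at h2
  simp only [Finset.sum_const, Nat.card_Ico, smul_eq_mul, mul_one] at h2
  split_ifs at h2 <;> omega

theorem SameClass.add_right {η η' : Sandpile S} (h : SameClass e η η') (ξ : Sandpile S) :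
    SameClass e (η + ξ) (η' + ξ) := by
  have hadd : ∀ (η : Sandpile S) (k : ℕ), profile e (η + ξ) k = profile e η k + profile e ξ k := by
    intro η k
    unfold profile
    split_ifs <;> simp
  refine ⟨fun k hk => ?_, ?_⟩
  · have := h.1 k hk
    rw [hadd, hadd]
    omega
  · have h2 := h.2
    simp only [moment, hadd, Nat.cast_add, mul_add, Finset.sum_add_distrib] at h2 ⊢
    rw [h2]

theorem SameClass.trans {η₁ η₂ η₃ : Sandpile S} (h : SameClass e η₁ η₂)
    (h' : SameClass e η₂ η₃) : SameClass e η₁ η₃ :=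
  ⟨fun k hk => (h.1 k hk).trans (h'.1 k hk), h.2.trans h'.2⟩

/-- Adding `2 (m + 1)` particles at every site changes neither parities nor moment. -/
theorem sameClass_add_const (η : Sandpile S) :
    SameClass e (η + fun _ => 2 * (m + 1)) η := by
  have hadd : ∀ k < m, profile e (η + fun _ => 2 * (m + 1)) k = profile e η k + 2 * (m + 1) := by
    intro k hk
    rw [profile_of_lt _ hk, profile_of_lt _ hk]
    rfl
  refine ⟨fun k hk => by rw [hadd k hk]; omega, Finset.sum_congr rfl fun k hk => ?_⟩
  rw [hadd k (Finset.mem_range.1 hk), Nat.cast_add (profile e η k), ZMod.natCast_self, add_zero]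

/-- A stable packed sandpile is determined by its parities and its moment. -/
theorem SameClass.eq_of_packed {η η' : Sandpile S} (h : SameClass e η η')
    (hη : ∀ k < m, profile e η k < 4) (hη' : ∀ k < m, profile e η' k < 4)
    (hp : IsPacked e η) (hp' : IsPacked e η') : η = η' := by
  obtain ⟨p, hpm, hgap⟩ := exists_gap_of_packed hp fun k hk => by have := hη k hk; omega
  obtain ⟨p', hpm', hgap'⟩ := exists_gap_of_packed hp' fun k hk => by have := hη' k hk; omega
  have hsum : ∀ q ≤ m, ∑ k ∈ Finset.range m, (k + 1) * (2 * (if k + 1 = q then 1 else 0)) =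
      2 * q := by
    intro q hq
    rcases Nat.eq_zero_or_pos q with rfl | hq0
    · exact Finset.sum_eq_zero fun k _ => by simp
    · rw [Finset.sum_eq_single_of_mem (q - 1) (Finset.mem_range.2 (by omega)) fun k _ hk => by
        rw [if_neg (by omega)]; rfl]
      rw [if_pos (by omega), Nat.sub_add_cancel hq0]
      ring
  have hnat : ∑ k ∈ Finset.range m, (k + 1) * profile e η k + 2 * p =
      ∑ k ∈ Finset.range m, (k + 1) * profile e η' k + 2 * p' := by
    rw [← hsum p hpm, ← hsum p' hpm', ← Finset.sum_add_distrib, ← Finset.sum_add_distrib]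
    refine Finset.sum_congr rfl fun k hk => ?_
    rw [Finset.mem_range] at hk
    rw [← mul_add, ← mul_add]
    congr 1
    have h1 := hgap k hk
    have h2 := hgap' k hk
    have h3 := h.1 k hk
    split_ifs at * <;> omega
  have hpp : p = p' := by
    have h1 : ((2 * p : ℕ) : ZMod (2 * (m + 1))) = ((2 * p' : ℕ) : ZMod (2 * (m + 1))) := by
      have h2 := congrArg (Nat.cast : ℕ → ZMod (2 * (m + 1))) hnat
      have h3 := h.2
      unfold moment at h3
      simp only [Nat.cast_add, Nat.cast_sum, Nat.cast_mul] at h2 h3 ⊢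
      rw [h3] at h2
      exact add_left_cancel h2
    rw [ZMod.natCast_eq_natCast_iff] at h1
    have := h1.eq_of_lt_of_lt (by omega) (by omega)
    omega
  refine profile_ext (e := e) fun k hk => ?_
  have h1 := hgap k hk
  have h2 := hgap' k hk
  have h3 := h.1 k hk
  rw [hpp, ← h2] at h1
  omega

/-- One step of the driven sandpile: add a particle at `v` and stabilize. -/
noncomputable def addStep (G : Multigraph V) {S : Set V} (η : Sandpile S) (v : {v : V // v ∉ S}) :
    Sandpile S := by
  classical exact G.stabilization (η + Pi.single v 1)

theorem driven_succ (η₀ : Sandpile S) (X : ℕ → {v : V // v ∉ S}) (k : ℕ) :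
    G.driven η₀ X (k + 1) = G.addStep (G.driven η₀ X k) (X k) := rfl

theorem driven_add_eq_foldl (η₀ : Sandpile S) (X : ℕ → {v : V // v ∉ S}) (t : ℕ)
    (w : List {v : V // v ∉ S}) (hw : ∀ i (hi : i < w.length), X (t + i) = w[i]) :
    G.driven η₀ X (t + w.length) = w.foldl G.addStep (G.driven η₀ X t) := by
  induction w generalizing t with
  | nil => rfl
  | cons v w ih =>
    have h0 : X t = v := hw 0 (by simp)
    rw [List.foldl_cons, List.length_cons, show t + (w.length + 1) = t + 1 + w.length by omega,
      ih (t + 1) fun i hi => ?_, driven_succ, h0]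
    have := hw (i + 1) (by simpa using hi)
    rw [show t + 1 + i = t + (i + 1) by omega, this]
    simp

/-- If every state in a finite set can be steered to `η`, then a single word steers all of them
through `η`. -/
theorem exists_universal_word {A Q : Type*} (step : Q → A → Q) (good : Set Q)
    (hfin : good.Finite) (hstep : ∀ q ∈ good, ∀ a, step q a ∈ good) (η : Q)
    (hreach : ∀ q ∈ good, ∃ w : List A, w.foldl step q = η) :
    ∃ w : List A, ∀ q ∈ good, ∃ w', w' <+: w ∧ w'.foldl step q = η := by
  have hfold : ∀ w : List A, ∀ q ∈ good, w.foldl step q ∈ good := by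
    intro w
    induction w with
    | nil => exact fun q hq => hq
    | cons a w ih => exact fun q hq => ih _ (hstep q hq a)
  have key : ∀ T : Set Q, T.Finite → T ⊆ good →
      ∃ w : List A, ∀ q ∈ T, ∃ w', w' <+: w ∧ w'.foldl step q = η := by
    intro T hT
    induction T, hT using Set.Finite.induction_on with
    | empty => exact fun _ => ⟨[], fun q hq => hq.elim⟩
    | @insert q T _ _ ih =>
      intro hsub
      obtain ⟨w, hw⟩ := ih ((subset_insert q T).trans hsub)
      obtain ⟨w₂, hw₂⟩ := hreach _ (hfold w q (hsub (mem_insert q T)))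
      refine ⟨w ++ w₂, fun q' hq' => ?_⟩
      rcases hq' with rfl | hq'
      · exact ⟨w ++ w₂, List.prefix_refl _, by rw [List.foldl_append, hw₂]⟩
      · obtain ⟨w', h1, h2⟩ := hw q' hq'
        exact ⟨w', h1.trans (List.prefix_append w w₂), h2⟩
  exact key good hfin le_rfl

namespace IsDoubledPath

variable (hG : G.IsDoubledPath e)
include hG

theorem isPacked_stabilization {η : Sandpile S} (h : IsPacked e η) :
    IsPacked e (G.stabilization η) :=
  hG.stabilization_induction (P := IsPacked e) h fun η' v h' hv => by
    have := PackedOn.insert h' (hG.intervalTopple η' hv)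
    rwa [insert_eq_of_mem (mem_univ _)] at this

theorem sameClass_stabilization (η : Sandpile S) : SameClass e (G.stabilization η) η := by
  refine ⟨fun k hk => hG.profile_stabilization_mod_two η hk, ?_⟩
  refine hG.stabilization_induction (P := fun η' => moment e η' = moment e η) rfl
    fun η' v h hv => Eq.trans ?_ h
  have h2 := ZMod.natCast_self (2 * (m + 1))
  push_cast at h2
  have := hG.sum_mul_profile_topple (fun k => (k : ZMod (2 * (m + 1)))) (by simp)
    (by push_cast; exact h2) η' hv
  unfold moment
  rw [this]
  push_cast
  ring

theorem isStable_addStep (η : Sandpile S) (v : {v : V // v ∉ S}) :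
    G.IsStable (G.addStep η v) :=
  (hG.isStabilization_stabilization _).2

theorem isPacked_addStep {η : Sandpile S} (h : IsPacked e η) (v : {v : V // v ∉ S}) :
    IsPacked e (G.addStep η v) := by
  refine hG.isPacked_stabilization fun i j hij hj hU => (h i j hij hj hU).trans ?_
  gcongr with k
  simp only [profile]
  gcongr
  split_ifs
  · exact Nat.le_add_right _ _
  · exact le_rfl

theorem isStable_foldl {η : Sandpile S} (h : G.IsStable η) (w : List {v : V // v ∉ S}) :
    G.IsStable (w.foldl G.addStep η) := by
  induction w generalizing η with
  | nil => exact h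
  | cons v w ih => exact ih (hG.isStable_addStep η v)

theorem isPacked_foldl {η : Sandpile S} (h : IsPacked e η) (w : List {v : V // v ∉ S}) :
    IsPacked e (w.foldl G.addStep η) := by
  induction w generalizing η with
  | nil => exact h
  | cons v w ih => exact ih (hG.isPacked_addStep h v)

theorem isStable_driven {η₀ : Sandpile S} (h : G.IsStable η₀) (X : ℕ → {v : V // v ∉ S}) (k : ℕ) :
    G.IsStable (G.driven η₀ X k) := by
  cases k with
  | zero => exact h
  | succ k => exact hG.isStable_addStep _ _

theorem isPacked_driven {η₀ : Sandpile S} (h : IsPacked e η₀) (X : ℕ → {v : V // v ∉ S}) (k : ℕ) :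
    IsPacked e (G.driven η₀ X k) := by
  induction k with
  | zero => exact h
  | succ k ih => exact hG.isPacked_addStep ih _

theorem sameClass_foldl [DecidableEq {v : V // v ∉ S}] (η : Sandpile S)
    (w : List {v : V // v ∉ S}) :
    SameClass e (w.foldl G.addStep η) (η + fun v => w.count v) := by
  induction w generalizing η with
  | nil => exact ⟨fun _ _ => rfl, rfl⟩
  | cons v w ih =>
    refine (ih (G.addStep η v)).trans ?_
    have h : SameClass e (G.addStep η v) (η + Pi.single v 1) := by
      unfold addStep
      convert hG.sameClass_stabilization _
    have h2 := h.add_right fun u => w.count u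
    convert h2 using 1
    funext u
    simp only [Pi.add_apply, List.count_cons, Pi.single_apply, beq_iff_eq]
    by_cases huv : u = v
    · subst huv; simp; omega
    · simp [huv, Ne.symm huv]

theorem addStep_eq_of_lt {η : Sandpile S} (h : G.IsStable η) {v : {v : V // v ∉ S}}
    (hv : η v < 3) [DecidableEq {v : V // v ∉ S}] : G.addStep η v = η + Pi.single v 1 := by
  have hs : G.IsStable (η + Pi.single v 1) := by
    intro u
    have := h u
    rw [hG.degree_eq] at this ⊢
    by_cases huv : u = v
    · subst huv; simp; omega
    · simpa [Pi.single_apply, huv] using this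
  have : G.IsStabilization (η + Pi.single v 1) (η + Pi.single v 1) :=
    ⟨Relation.ReflTransGen.refl, hs⟩
  unfold addStep
  convert (hG.isStabilization_stabilization _).unique this

/-- Adding particles until every site holds three makes a stable sandpile packed. -/
theorem exists_word_isPacked {η : Sandpile S} (h : G.IsStable η) :
    ∃ w : List {v : V // v ∉ S}, IsPacked e (w.foldl G.addStep η) := by
  classical
  have : Fintype {v : V // v ∉ S} := Fintype.ofEquiv _ e.symm
  have key : ∀ n : ℕ, ∀ η : Sandpile S, G.IsStable η → 3 * Fintype.card {v : V // v ∉ S} ≤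
      n + ∑ v, η v → ∃ w : List {v : V // v ∉ S}, IsPacked e (w.foldl G.addStep η) := by
    intro n
    induction n with
    | zero =>
      intro η hη hn
      have hle : ∀ v, η v ≤ 3 := fun v => by have := hη v; rw [hG.degree_eq] at this; omega
      have h3 : ∀ v, η v = 3 := by
        by_contra hcon
        push Not at hcon
        obtain ⟨v, hv⟩ := hcon
        have : ∑ v, η v < ∑ _v : {v : V // v ∉ S}, 3 :=
          Finset.sum_lt_sum (fun v _ => hle v) ⟨v, Finset.mem_univ v, by have := hle v; omega⟩
        rw [Finset.sum_const, Finset.card_univ, smul_eq_mul] at this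
        omega
      refine ⟨[], packedOn_of_gap (p := 0) fun k hk => ?_⟩
      rw [List.foldl_nil, profile_of_lt _ hk, h3]
      rfl
    | succ n ih =>
      intro η hη hn
      by_cases hlt : ∃ v, η v < 3
      · obtain ⟨v, hv⟩ := hlt
        obtain ⟨w, hw⟩ := ih (G.addStep η v) (hG.isStable_addStep η v) (by
          rw [hG.addStep_eq_of_lt hη hv]
          simp only [Pi.add_apply, Finset.sum_add_distrib, Finset.sum_pi_single', Finset.mem_univ,
            if_true]
          omega)
        exact ⟨v :: w, hw⟩
      · push Not at hlt
        refine ih η hη ?_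
        have : ∑ _v : {v : V // v ∉ S}, 3 ≤ ∑ v, η v := Finset.sum_le_sum fun v _ => hlt v
        rw [Finset.sum_const, Finset.card_univ, smul_eq_mul] at this
        omega
  exact key _ η h (Nat.le_add_right _ _)

/-- A stable packed sandpile is accessible from every stable sandpile: first make the sandpile
packed, then add at each site the missing number of particles plus `2 (m + 1)`. -/
theorem exists_word_foldl_eq {η₀ η : Sandpile S} (h₀ : G.IsStable η₀) (hs : G.IsStable η)
    (hp : IsPacked e η) : ∃ w : List {v : V // v ∉ S}, w.foldl G.addStep η₀ = η := by
  let _ : DecidableEq {v : V // v ∉ S} := Classical.decEq _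
  have : Finite {v : V // v ∉ S} := Finite.of_equiv _ e.symm
  obtain ⟨w₁, hw₁⟩ := hG.exists_word_isPacked h₀
  have hs₁ := hG.isStable_foldl h₀ w₁
  set η₁ := w₁.foldl G.addStep η₀ with hη₁
  set w₂ : List {v : V // v ∉ S} := (Finsupp.toMultiset
    (Finsupp.equivFunOnFinite.symm fun v => η v + 2 * (m + 1) - η₁ v)).toList with hw₂
  have hcount : ∀ v, w₂.count v = η v + 2 * (m + 1) - η₁ v := fun v => by
    rw [hw₂, ← Multiset.coe_count, Multiset.coe_toList, Finsupp.count_toMultiset]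
    rfl
  refine ⟨w₁ ++ w₂, ?_⟩
  rw [List.foldl_append, ← hη₁]
  have hcl := hG.sameClass_foldl η₁ w₂
  have heq : (η₁ + fun v => w₂.count v) = η + fun _ => 2 * (m + 1) := by
    funext v
    have h1 := hs₁ v
    rw [hG.degree_eq] at h1
    have h2 := (e v).2
    simp only [Pi.add_apply, hcount]
    omega
  rw [heq] at hcl
  exact (hcl.trans (sameClass_add_const η)).eq_of_packed
    (hG.isStable_iff.1 (hG.isStable_foldl hs₁ w₂)) (hG.isStable_iff.1 hs)
    (hG.isPacked_foldl hw₁ w₂) hp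

end IsDoubledPath

end Multigraph

/-! ### The driven sandpile visits every packed state -/

/-- An independent sequence of uniformly distributed letters almost surely contains every given
word. -/
theorem ae_exists_word {A : Type*} [MeasurableSpace A] [MeasurableSingletonClass A] [Finite A]
    [Nonempty A] (w : List A) :
    ∀ᵐ X ∂Measure.infinitePi fun _ : ℕ => (uniformOn univ : Measure A),
      ∃ t, ∀ i (hi : i < w.length), X (t + i) = w[i] := by
  have hprob : IsProbabilityMeasure (uniformOn univ : Measure A) :=
    isProbabilityMeasure_uniformOn finite_univ univ_nonempty
  set L := w.length with hL
  set ν : Measure (Fin L → A) := Measure.infinitePi fun _ => (uniformOn univ : Measure A) with hν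
  set w' : Fin L → A := fun i => w[i] with hw'
  -- cut the sequence into consecutive blocks of length `L`
  have hinj : Function.Injective fun p : ℕ × Fin L => p.1 * L + p.2 := by
    rintro ⟨a, i⟩ ⟨b, j⟩ hab
    simp only at hab
    have hLpos : 0 < L := i.pos
    have hdiv : ∀ (c : ℕ) (k : Fin L), (c * L + k) / L = c := fun c k => by
      rw [add_comm, Nat.add_mul_div_right _ _ hLpos, Nat.div_eq_of_lt k.2, zero_add]
    have h1 : a = b := by rw [← hdiv a i, hab, hdiv]
    subst h1
    simp only [Prod.mk.injEq, true_and]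
    exact Fin.ext (by omega)
  have hblocks : (Measure.infinitePi fun _ : ℕ => (uniformOn univ : Measure A)).map
      (fun X t (i : Fin L) => X (t * L + i)) = Measure.infinitePi fun _ : ℕ => ν := by
    have h1 := Measure.map_infinitePi_infinitePi_of_inj
      (P := fun _ : ℕ => (uniformOn univ : Measure A)) hinj
    have h2 := Measure.infinitePi_map_curry (ι := ℕ) (κ := Fin L)
      fun _ _ => (uniformOn univ : Measure A)
    rw [← h1, Measure.map_map (by fun_prop) (by fun_prop)] at h2
    exact h2
  have hpos : ν {w'} ≠ 0 := by
    rw [hν, Measure.infinitePi_singleton_of_fintype]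
    refine Finset.prod_ne_zero_iff.2 fun i _ => ?_
    rw [Ne, uniformOn_eq_zero_iff finite_univ]
    simp
  have hlt : ν {w'}ᶜ < 1 := by
    rw [prob_compl_eq_one_sub (measurableSet_singleton _)]
    exact ENNReal.sub_lt_self ENNReal.one_ne_top one_ne_zero hpos
  have hnull : (Measure.infinitePi fun _ : ℕ => ν) {Y | ∀ t, Y t ≠ w'} = 0 := by
    refine le_antisymm (ge_of_tendsto (ENNReal.tendsto_pow_atTop_nhds_zero_of_lt_one hlt)
      (Eventually.of_forall fun J => ?_)) zero_le
    calc (Measure.infinitePi fun _ : ℕ => ν) {Y | ∀ t, Y t ≠ w'}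
        ≤ (Measure.infinitePi fun _ : ℕ => ν) (Set.pi (Finset.range J) fun _ => {w'}ᶜ) :=
          measure_mono fun Y hY t _ => hY t
      _ = ν {w'}ᶜ ^ J := by
          rw [Measure.infinitePi_pi _ fun _ _ => (measurableSet_singleton _).compl]
          simp
  have hae : ∀ᵐ Y ∂Measure.infinitePi fun _ : ℕ => ν, ∃ t, Y t = w' := by
    rw [ae_iff]
    simpa using hnull
  rw [← hblocks] at hae
  have hmeas : Measurable fun (X : ℕ → A) (t : ℕ) (i : Fin L) => X (t * L + i) :=
    measurable_pi_lambda _ fun t => measurable_pi_lambda _ fun i => measurable_pi_apply _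
  filter_upwards [ae_of_ae_map hmeas.aemeasurable hae] with X ⟨t, ht⟩
  exact ⟨t * L, fun i hi => congrFun ht ⟨i, hi⟩⟩

namespace Multigraph

variable {V : Type*} {G : Multigraph V} {S : Set V} {m : ℕ}
  {e : {v : V // v ∉ S} ≃ Fin m}

theorem uniformSites_isProbabilityMeasure (S : Set V) [Finite {v : V // v ∉ S}]
    [Nonempty {v : V // v ∉ S}] : IsProbabilityMeasure (uniformSites S) := by
  let _ : MeasurableSpace {v : V // v ∉ S} := ⊤
  have : MeasurableSingletonClass {v : V // v ∉ S} := ⟨fun _ => trivial⟩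
  have hprob : IsProbabilityMeasure (uniformOn univ : Measure {v : V // v ∉ S}) :=
    isProbabilityMeasure_uniformOn finite_univ univ_nonempty
  exact inferInstanceAs (IsProbabilityMeasure
    (Measure.infinitePi fun _ : ℕ => (uniformOn univ : Measure {v : V // v ∉ S})))

theorem uniformSites_ae_exists_word (S : Set V) [Finite {v : V // v ∉ S}]
    [Nonempty {v : V // v ∉ S}] (w : List {v : V // v ∉ S}) :
    ∀ᵐ X ∂uniformSites S, ∃ t, ∀ i (hi : i < w.length), X (t + i) = w[i] := by
  let _ : MeasurableSpace {v : V // v ∉ S} := ⊤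
  have : MeasurableSingletonClass {v : V // v ∉ S} := ⟨fun _ => trivial⟩
  exact ae_exists_word w

namespace IsDoubledPath

variable (hG : G.IsDoubledPath e)
include hG

theorem finite_isStable : {η : Sandpile S | G.IsStable η}.Finite := by
  have : Finite {v : V // v ∉ S} := Finite.of_equiv _ e.symm
  refine (Set.Finite.pi' fun _ : {v : V // v ∉ S} => finite_Iio 4).subset fun η hη v => ?_
  have := hη v
  rwa [hG.degree_eq] at this

/-- The recurrent sandpiles on a doubled path are the stable packed ones. -/
theorem isRecurrent_iff (hm : 0 < m) {η : Sandpile S} :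
    G.IsRecurrent η ↔ G.IsStable η ∧ IsPacked e η := by
  have : Finite {v : V // v ∉ S} := Finite.of_equiv _ e.symm
  have : Nonempty {v : V // v ∉ S} := ⟨e.symm ⟨0, hm⟩⟩
  have := uniformSites_isProbabilityMeasure S
  refine ⟨fun h => ⟨h.1, ?_⟩, fun h => ⟨h.1, fun η₀ h₀ => ?_⟩⟩
  · -- started from the sandpile with three particles everywhere, only packed states are visited
    have h3 : G.IsStable (fun _ : {v : V // v ∉ S} => 3) := fun v => by
      rw [hG.degree_eq]; norm_num
    have hp : IsPacked e (fun _ : {v : V // v ∉ S} => 3) :=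
      packedOn_of_gap (p := 0) fun k hk => by rw [profile_of_lt _ hk]; rfl
    obtain ⟨X, k, hk⟩ := (h.2 _ h3).exists
    rw [← hk]
    exact hG.isPacked_driven hp X k
  · obtain ⟨w, hw⟩ := exists_universal_word G.addStep {η : Sandpile S | G.IsStable η}
      hG.finite_isStable (fun q _ v => hG.isStable_addStep q v) η
      fun q hq => hG.exists_word_foldl_eq hq h.1 h.2
    filter_upwards [uniformSites_ae_exists_word S w] with X ⟨t, ht⟩
    obtain ⟨w', ⟨w'', rfl⟩, hw'⟩ := hw _ (hG.isStable_driven h₀ X t)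
    refine ⟨t + w'.length, ?_⟩
    rw [driven_add_eq_foldl η₀ X t w' fun i hi => ?_, hw']
    rw [ht i (by rw [List.length_append]; omega), List.getElem_append_left]

end IsDoubledPath

/-! ### The stationary density -/

/-- The stable packed sandpile whose parities are `a.1` and whose site without a pair is the one
numbered `a.2` when counting from `1`; for `a.2 = 0` every site holds a pair. -/
def packedState (e : {v : V // v ∉ S} ≃ Fin m) (a : ({v : V // v ∉ S} → Bool) × Fin (m + 1)) :
    Sandpile S :=
  fun v => 2 * (if (e v).succ = a.2 then 0 else 1) + (a.1 v).toNat

theorem packedState_div_two (a : ({v : V // v ∉ S} → Bool) × Fin (m + 1)) (v : {v : V // v ∉ S}) :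
    packedState e a v / 2 = if (e v).succ = a.2 then 0 else 1 := by
  have := (a.1 v).toNat_lt
  unfold packedState
  split_ifs <;> omega

theorem packedState_mod_two (a : ({v : V // v ∉ S} → Bool) × Fin (m + 1)) (v : {v : V // v ∉ S}) :
    packedState e a v % 2 = (a.1 v).toNat := by
  have := (a.1 v).toNat_lt
  unfold packedState
  split_ifs <;> omega

theorem packedState_injective : Function.Injective (packedState e) := by
  rintro ⟨b, p⟩ ⟨b', p'⟩ h
  have hb : b = b' := by
    funext v
    have := congrArg (· % 2) (congrFun h v)
    simp only [packedState_mod_two] at this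
    revert this; cases b v <;> cases b' v <;> simp
  have hp : ∀ v, (e v).succ = p ↔ (e v).succ = p' := by
    intro v
    have := congrArg (· / 2) (congrFun h v)
    simp only [packedState_div_two] at this
    split_ifs at this <;> simp_all
  have hp' : p = p' := by
    rcases Fin.eq_zero_or_eq_succ p with rfl | ⟨i, rfl⟩
    · rcases Fin.eq_zero_or_eq_succ p' with rfl | ⟨i, rfl⟩
      · rfl
      · exact ((hp (e.symm i)).2 (by simp)).symm.trans (by simp)
    · simpa using (hp (e.symm i)).1 (by simp)
  rw [hb, hp']

theorem IsDoubledPath.isRecurrent_iff_mem_range (hG : G.IsDoubledPath e) (hm : 0 < m)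
    {η : Sandpile S} : G.IsRecurrent η ↔ η ∈ range (packedState e) := by
  rw [hG.isRecurrent_iff hm]
  constructor
  · rintro ⟨hs, hp⟩
    have hs' := hG.isStable_iff.1 hs
    obtain ⟨p, hpm, hgap⟩ := exists_gap_of_packed hp fun k hk => by have := hs' k hk; omega
    refine ⟨⟨fun v => decide (η v % 2 = 1), ⟨p, by omega⟩⟩, ?_⟩
    funext v
    have h1 := hgap (e v) (e v).2
    have h2 : ((e v).succ = (⟨p, by omega⟩ : Fin (m + 1))) ↔ (e v : ℕ) + 1 = p := by
      simp [Fin.ext_iff]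
    rw [profile_apply] at h1
    simp only [packedState, h2, ← h1]
    rcases Nat.mod_two_eq_zero_or_one (η v) with h | h <;> simp [h] <;> omega
  · rintro ⟨a, rfl⟩
    refine ⟨fun v => ?_, packedOn_of_gap (p := a.2) fun k hk => ?_⟩
    · have := packedState_div_two (e := e) a v
      rw [hG.degree_eq]
      split_ifs at this <;> omega
    · rw [profile_of_lt _ hk, packedState_div_two, Equiv.apply_symm_apply]
      simp [Fin.ext_iff]

theorem sum_toNat_apply {T : Type*} [Fintype T] [DecidableEq T] (v : T) :
    ∑ b : T → Bool, ((b v).toNat : ℝ) = (Fintype.card (T → Bool) : ℝ) / 2 := by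
  have h1 : ∑ b : T → Bool, ((b v).toNat : ℝ) = ∑ b : T → Bool, ((!b v).toNat : ℝ) := by
    refine Fintype.sum_equiv (Equiv.arrowCongr (Equiv.refl T) Equiv.boolNot) _ _ fun b => ?_
    simp
  have h2 : ∑ b : T → Bool, (((b v).toNat : ℝ) + ((!b v).toNat : ℝ)) =
      Fintype.card (T → Bool) := by
    rw [Finset.sum_congr rfl fun b _ => show ((b v).toNat : ℝ) + ((!b v).toNat : ℝ) = 1 by
      cases b v <;> simp]
    simp
  rw [Finset.sum_add_distrib, ← h1] at h2
  linarith

theorem sum_density_packedState [Fintype {v : V // v ∉ S}] [DecidableEq {v : V // v ∉ S}]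
    (hm : 0 < m) : ∑ a, density (packedState e a) =
      Fintype.card ({v : V // v ∉ S} → Bool) * ((5 / 2 : ℝ) * (m + 1) - 2) := by
  have hcard : Fintype.card {v : V // v ∉ S} = m := by
    rw [Fintype.card_congr e, Fintype.card_fin]
  have hm' : (m : ℝ) ≠ 0 := by positivity
  set N : ℝ := (Fintype.card ({v : V // v ∉ S} → Bool) : ℝ) with hN
  have hsite : ∀ v : {v : V // v ∉ S}, ∑ a, (packedState e a v : ℝ) =
      N * ((5 / 2 : ℝ) * (m + 1) - 2) := by
    intro v
    have h1 : ∀ a, (packedState e a v : ℝ) =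
        2 - 2 * (if (e v).succ = a.2 then 1 else 0) + ((a.1 v).toNat : ℝ) := fun a => by
      unfold packedState
      split_ifs <;> push_cast <;> ring
    simp_rw [h1, Fintype.sum_prod_type, Finset.sum_add_distrib, Finset.sum_sub_distrib,
      ← Finset.mul_sum, Finset.sum_ite_eq, Finset.mem_univ, if_true]
    simp only [Finset.sum_const, Finset.card_univ, Fintype.card_fin, nsmul_eq_mul]
    rw [← Finset.mul_sum, sum_toNat_apply]
    push_cast
    ring
  have hdens : ∀ a, density (packedState e a) = (∑ v, (packedState e a v : ℝ)) / m := fun a => by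
    rw [density, finsum_eq_sum_of_fintype, Nat.card_eq_fintype_card, hcard]
  simp_rw [hdens]
  rw [← Finset.sum_div, Finset.sum_comm]
  simp_rw [hsite]
  rw [Finset.sum_const, Finset.card_univ, hcard, nsmul_eq_mul]
  field_simp

theorem integral_uniformOn_range {A B : Type*} [Fintype A] [Nonempty A] [MeasurableSpace B]
    [MeasurableSingletonClass B] {φ : A → B} (hφ : Function.Injective φ) (f : B → ℝ) :
    ∫ x, f x ∂uniformOn (range φ) = (∑ a, f (φ a)) / Fintype.card A := by
  classical
  have hr : range φ = ((Finset.univ.map ⟨φ, hφ⟩ : Finset B) : Set B) := by simp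
  have hint : IntegrableOn f ((Finset.univ.map ⟨φ, hφ⟩ : Finset B) : Set B) Measure.count := by
    rw [← ((Finset.univ.map ⟨φ, hφ⟩ : Finset B) : Set B).biUnion_of_singleton]
    exact integrableOn_finset_iUnion.2 fun b _ => by simp
  rw [uniformOn, ProbabilityTheory.cond, integral_smul_measure, hr, Measure.count_apply_finset,
    setIntegral_finset _ hint]
  simp [Measure.real, div_eq_inv_mul]

theorem IsDoubledPath.stationaryDensity_eq (hG : G.IsDoubledPath e) (hm : 0 < m) :
    G.stationaryDensity S = 5 / 2 - 2 / (m + 1) := by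
  let _ : Fintype {v : V // v ∉ S} := Fintype.ofEquiv _ e.symm
  let _ : DecidableEq {v : V // v ∉ S} := Classical.decEq _
  have hset : {η : Sandpile S | G.IsRecurrent η} = range (packedState e) :=
    Set.ext fun η => hG.isRecurrent_iff_mem_range hm
  rw [stationaryDensity, hset, integral_uniformOn_range packedState_injective,
    sum_density_packedState hm, Fintype.card_prod, Fintype.card_fin]
  have : (Fintype.card ({v : V // v ∉ S} → Bool) : ℝ) ≠ 0 := by
    exact_mod_cast Fintype.card_ne_zero
  have : (m : ℝ) + 1 ≠ 0 := by positivity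
  push_cast
  field_simp

end Multigraph

/-! ### Cycles and intervals as doubled paths -/

/-- The enumeration `v ↦ v - 1` of the vertices of the bracelet other than the sink `0`. -/
def braceletEquiv (m : ℕ) : {v : ZMod (m + 1) // v ∉ ({0} : Set (ZMod (m + 1)))} ≃ Fin m where
  toFun v := ⟨v.1.val - 1, by
    have h1 := ZMod.val_lt v.1
    have h2 : v.1.val ≠ 0 := fun h => v.2 ((ZMod.val_eq_zero _).1 h)
    omega⟩
  invFun i := ⟨((i + 1 : ℕ) : ZMod (m + 1)), fun h => by
    have h1 := congrArg ZMod.val (mem_singleton_iff.1 h)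
    rw [ZMod.val_natCast_of_lt (by omega), ZMod.val_zero] at h1
    omega⟩
  left_inv v := by
    have h2 : v.1.val ≠ 0 := fun h => v.2 ((ZMod.val_eq_zero _).1 h)
    refine Subtype.ext ?_
    simp only
    rw [Nat.sub_add_cancel (by omega), ZMod.natCast_zmod_val]
  right_inv i := by
    refine Fin.ext ?_
    simp only
    rw [ZMod.val_natCast_of_lt (by omega), Nat.add_sub_cancel]

namespace Multigraph

theorem isDoubledPath_bracelet (m : ℕ) : (bracelet (m + 1)).IsDoubledPath (braceletEquiv m) where
  degree_eq v := by
    rw [degree, finsum_eq_sum_of_fintype]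
    have : ∀ w, (bracelet (m + 1)).mult v w =
        2 * ((if w = v + 1 then 1 else 0) + (if v - 1 = w then 1 else 0)) := fun w => by
      simp only [bracelet, doubledLine, sub_eq_iff_eq_add]
    simp_rw [this, ← Finset.mul_sum, Finset.sum_add_distrib, Finset.sum_ite_eq,
      Finset.sum_ite_eq', Finset.mem_univ, if_true]
    norm_num
  mult_eq v w := by
    have key : ∀ v w : {v : ZMod (m + 1) // v ∉ ({0} : Set (ZMod (m + 1)))},
        (w : ZMod (m + 1)) = v + 1 ↔ (braceletEquiv m w : ℕ) = braceletEquiv m v + 1 := by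
      intro v w
      have hv : v.1.val ≠ 0 := fun h => v.2 ((ZMod.val_eq_zero _).1 h)
      have hw : w.1.val ≠ 0 := fun h => w.2 ((ZMod.val_eq_zero _).1 h)
      have hlt := ZMod.val_lt w.1
      have hlt' := ZMod.val_lt v.1
      have hval : (v.1 + 1).val = (v.1.val + 1) % (m + 1) := by
        conv_lhs => rw [← ZMod.natCast_zmod_val v.1]
        rw [← Nat.cast_add_one, ZMod.val_natCast]
      change w.1 = v.1 + 1 ↔ w.1.val - 1 = v.1.val - 1 + 1
      rw [← (ZMod.val_injective (m + 1)).eq_iff, hval]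
      rcases Nat.lt_or_ge (v.1.val + 1) (m + 1) with h | h
      · rw [Nat.mod_eq_of_lt h]; omega
      · rw [show v.1.val + 1 = m + 1 by omega, Nat.mod_self]; omega
    simp only [bracelet, doubledLine, key]

theorem infiniteBracelet_mult_ne_zero {v w : ℤ} :
    infiniteBracelet.mult v w ≠ 0 ↔ w = v + 1 ∨ v = w + 1 := by
  rw [infiniteBracelet_mult]
  split_ifs <;> simp <;> omega

/-- The enumeration of the interval `W = [a, b]`, viewed as the set of non-sink vertices of the
graph induced on a larger vertex set `W'`. -/
def intervalEquiv {W W' : Set ℤ} {a b : ℤ} (hW : ∀ v, v ∈ W ↔ a ≤ v ∧ v ≤ b) (hWW' : W ⊆ W') :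
    {v : W' // v ∉ {v : W' | (v : ℤ) ∉ W}} ≃ Fin (b + 1 - a).toNat where
  toFun v := ⟨((v : ℤ) - a).toNat, by
    have h := (hW _).1 (not_not.1 v.2)
    omega⟩
  invFun i := ⟨⟨a + i, hWW' ((hW _).2 (by omega))⟩, fun h => h ((hW _).2 (by simp only; omega))⟩
  left_inv v := by
    have h := (hW _).1 (not_not.1 v.2)
    refine Subtype.ext (Subtype.ext ?_)
    simp only
    omega
  right_inv i := by
    refine Fin.ext ?_
    simp

theorem isDoubledPath_induce {W W' : Set ℤ} {a b : ℤ} (hW : ∀ v, v ∈ W ↔ a ≤ v ∧ v ≤ b)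
    (hWW' : W ⊆ W') (hnb : ∀ v ∈ W, ∀ w, infiniteBracelet.mult v w ≠ 0 → w ∈ W') :
    (infiniteBracelet.induce W').IsDoubledPath (intervalEquiv hW hWW') where
  degree_eq v := by
    have hv : ((v : W') : ℤ) ∈ W := not_not.1 v.2
    rw [← infiniteBracelet_degree ((v : W') : ℤ), degree, degree]
    change ∑ᶠ w : W', infiniteBracelet.mult (v : W') w = _
    rw [finsum_set_coe_eq_finsum_mem (f := fun w => infiniteBracelet.mult (v : W') w) W',
      finsum_mem_def, indicator_eq_self.2 fun w hw => hnb _ hv w hw]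
  mult_eq v w := by
    have hv := (hW _).1 (not_not.1 v.2)
    have hw := (hW _).1 (not_not.1 w.2)
    change 2 * ((if ((w : W') : ℤ) = (v : W') + 1 then 1 else 0) +
      (if ((v : W') : ℤ) = (w : W') + 1 then 1 else 0)) = 2 * ((if
        (((w : W') : ℤ) - a).toNat = (((v : W') : ℤ) - a).toNat + 1 then 1 else 0) +
      (if (((v : W') : ℤ) - a).toNat = (((w : W') : ℤ) - a).toNat + 1 then 1 else 0))
    congr 2
    · exact if_congr (by omega) rfl rfl
    · exact if_congr (by omega) rfl rfl

theorem IsExhaustion.exists_eq_Icc {W : ℕ → Set ℤ} (hW : infiniteBracelet.IsExhaustion W) {n : ℕ}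
    (hne : (W n).Nonempty) : ∃ a b, a ≤ b ∧ W n = Icc a b := by
  obtain ⟨a, ha, hmin⟩ := exists_min_image (W n) id (hW.finite n) hne
  obtain ⟨b, hb, hmax⟩ := exists_max_image (W n) id (hW.finite n) hne
  refine ⟨a, b, hmin b hb, Subset.antisymm (fun v hv => ⟨hmin v hv, hmax v hv⟩) fun v hv => ?_⟩
  by_contra hvW
  -- a walk with unit steps that avoids `v` stays to the left of `v`
  have key : ∀ y, Relation.ReflTransGen
      (fun x y => x ∈ W n ∧ y ∈ W n ∧ infiniteBracelet.mult x y ≠ 0) a y → y < v := by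
    intro y hy
    induction hy with
    | refl => exact lt_of_le_of_ne hv.1 fun h => hvW (h ▸ ha)
    | tail _ hxy ih =>
      obtain ⟨_, hyW, hmult⟩ := hxy
      rw [infiniteBracelet_mult_ne_zero] at hmult
      have := ne_of_mem_of_not_mem hyW hvW
      omega
  exact absurd (key b (hW.connected n a ha b hb)) (not_lt.2 hv.2)

theorem IsExhaustion.stationaryDensity_eq {W : ℕ → Set ℤ} (hW : infiniteBracelet.IsExhaustion W)
    {n : ℕ} (hne : (W n).Nonempty) :
    (infiniteBracelet.induce (W (n + 1))).stationaryDensity {v | (v : ℤ) ∉ W n} =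
      5 / 2 - 2 / ((W n).ncard + 1) := by
  obtain ⟨a, b, hab, hWn⟩ := hW.exists_eq_Icc hne
  have hcard : (W n).ncard = (b + 1 - a).toNat := by
    rw [hWn, ← Finset.coe_Icc, ncard_coe_finset, Int.card_Icc]
  rw [hcard]
  exact (isDoubledPath_induce (fun v => by rw [hWn, mem_Icc]) (hW.mono n.le_succ)
    (hW.neighbours n)).stationaryDensity_eq (by omega)

theorem IsExhaustion.tendsto_ncard {W : ℕ → Set ℤ} (hW : infiniteBracelet.IsExhaustion W) :
    Tendsto (fun n => (W n).ncard) atTop atTop := by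
  have hmem : ∀ v : ℤ, ∀ᶠ n in atTop, v ∈ W n := by
    intro v
    obtain ⟨N, hN⟩ := mem_iUnion.1 (hW.union ▸ mem_univ v : v ∈ ⋃ n, W n)
    exact eventually_atTop.2 ⟨N, fun n hn => hW.mono hn hN⟩
  refine tendsto_atTop.2 fun K => ?_
  have hall : ∀ᶠ n in atTop, ∀ k ∈ Finset.range K, (k : ℤ) ∈ W n :=
    (Finset.eventually_all _).2 fun k _ => hmem k
  filter_upwards [hall] with n hn
  have hsub : (((Finset.range K).map Nat.castEmbedding : Finset ℤ) : Set ℤ) ⊆ W n := by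
    intro v hv
    simp only [Finset.coe_map, mem_image, Finset.mem_coe] at hv
    obtain ⟨k, hk, rfl⟩ := hv
    exact hn k hk
  have := ncard_le_ncard hsub (hW.finite n)
  rwa [ncard_coe_finset, Finset.card_map, Finset.card_range] at this

theorem tendsto_five_halves_sub {f : ℕ → ℕ} (hf : Tendsto f atTop atTop) :
    Tendsto (fun n => (5 / 2 - 2 / ((f n : ℝ) + 1) : ℝ)) atTop (𝓝 (5 / 2)) := by
  have h1 : Tendsto (fun n => (f n : ℝ) + 1) atTop atTop :=
    tendsto_atTop_add_const_right _ _ (tendsto_natCast_atTop_atTop.comp hf)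
  simpa using (h1.const_div_atTop 2).const_sub (5 / 2)

theorem isExhaustion_Icc : infiniteBracelet.IsExhaustion fun n : ℕ => Icc (-n : ℤ) n where
  finite n := finite_Icc _ _
  connected n := by
    have : Std.Symm fun x y : ℤ => x ∈ Icc (-n : ℤ) n ∧ y ∈ Icc (-n : ℤ) n ∧
        infiniteBracelet.mult x y ≠ 0 :=
      ⟨fun x y ⟨hx, hy, h⟩ => ⟨hy, hx, by rwa [infiniteBracelet.symm]⟩⟩
    have hstart : ∀ k : ℕ, (-n + k : ℤ) ≤ n → Relation.ReflTransGen (fun x y : ℤ =>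
        x ∈ Icc (-n : ℤ) n ∧ y ∈ Icc (-n : ℤ) n ∧ infiniteBracelet.mult x y ≠ 0) (-n)
        (-n + k) := by
      intro k
      induction k with
      | zero => intro _; simpa using Relation.ReflTransGen.refl
      | succ k ih =>
        intro hk
        push_cast at hk
        refine (ih (by omega)).tail ⟨by rw [mem_Icc]; omega, by rw [mem_Icc]; push_cast; omega, ?_⟩
        rw [infiniteBracelet_mult_ne_zero]
        left
        push_cast
        ring
    have hall : ∀ v ∈ Icc (-n : ℤ) n, Relation.ReflTransGen (fun x y : ℤ =>
        x ∈ Icc (-n : ℤ) n ∧ y ∈ Icc (-n : ℤ) n ∧ infiniteBracelet.mult x y ≠ 0) (-n) v := by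
      intro v hv
      rw [mem_Icc] at hv
      have := hstart (v + n).toNat (by omega)
      rwa [show (-n + (v + n).toNat : ℤ) = v by omega] at this
    exact fun u hu v hv => (_root_.symm (hall u hu)).trans (hall v hv)
  mono i j hij := Icc_subset_Icc (by omega) (by omega)
  union := eq_univ_of_forall fun v => mem_iUnion.2 ⟨v.natAbs, by rw [mem_Icc]; omega⟩
  neighbours n v hv w h := by
    rw [infiniteBracelet_mult_ne_zero] at h
    rw [mem_Icc] at hv ⊢
    push_cast
    omega

theorem hasStationaryDensity_infiniteBracelet :
    infiniteBracelet.HasStationaryDensity (5 / 2) := by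
  refine ⟨⟨_, isExhaustion_Icc⟩, fun W hW => ?_⟩
  refine (tendsto_five_halves_sub hW.tendsto_ncard).congr' ?_
  filter_upwards [hW.tendsto_ncard.eventually_gt_atTop 0] with n hn
  exact (hW.stationaryDensity_eq ((ncard_pos (hW.finite n)).1 hn)).symm

theorem tendsto_stationaryDensity_bracelet :
    Tendsto (fun n : ℕ => (bracelet n).stationaryDensity {0}) atTop (𝓝 (5 / 2)) := by
  rw [← tendsto_add_atTop_iff_nat 1]
  refine (tendsto_five_halves_sub tendsto_id).congr' ?_
  filter_upwards [eventually_gt_atTop 0] with m hm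
  exact ((isDoubledPath_bracelet m).stationaryDensity_eq hm).symm

end Multigraph

/-! ### The final density -/

theorem exists_abs_sub_le_of_tendsto_div {s : ℕ → ℝ} {μ : ℝ}
    (h : Tendsto (fun n : ℕ => s n / n) atTop (𝓝 μ)) {ε : ℝ} (hε : 0 < ε) :
    ∃ C, ∀ k : ℕ, |s k - μ * k| ≤ ε * k + C := by
  obtain ⟨M, hM⟩ := Metric.tendsto_atTop.1 h ε hε
  refine ⟨∑ k ∈ Finset.range (M + 1), |s k - μ * k|, fun k => ?_⟩
  rcases Nat.lt_or_ge k (M + 1) with hk | hk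
  · have h1 := Finset.single_le_sum (f := fun k : ℕ => |s k - μ * k|) (fun i _ => abs_nonneg _)
      (Finset.mem_range.2 hk)
    have : 0 ≤ ε * k := by positivity
    linarith
  · have h1 := (hM k (by omega)).le
    have hk0 : (0 : ℝ) < k := by exact_mod_cast (show 0 < k by omega)
    rw [Real.dist_eq, show s k / k - μ = (s k - μ * k) / k by field_simp, abs_div,
      abs_of_pos hk0, div_le_iff₀ hk0] at h1
    have : 0 ≤ ∑ k ∈ Finset.range (M + 1), |s k - μ * k| :=
      Finset.sum_nonneg fun i _ => abs_nonneg _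
    linarith

/-- The sandpile on the bracelet with `m` non-sink vertices read off from an infinite sequence. -/
def braceletSandpile (m : ℕ) (ω : ℕ → ℕ) : Multigraph.Sandpile ({0} : Set (ZMod (m + 1))) :=
  fun v => ω (braceletEquiv m v)

theorem profile_braceletSandpile (ω : ℕ → ℕ) {m k : ℕ} (hk : k < m) :
    Multigraph.profile (braceletEquiv m) (braceletSandpile m ω) k = ω k := by
  rw [Multigraph.profile_of_lt _ hk, braceletSandpile, Equiv.apply_symm_apply]

/-- The number of complete pairs of particles in the stabilization of the first `m` terms of `ω`. -/
noncomputable def finalPairs (ω : ℕ → ℕ) (m : ℕ) : ℕ :=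
  ∑ k ∈ Finset.range m, Multigraph.profile (braceletEquiv m)
    ((bracelet (m + 1)).stabilization (braceletSandpile m ω)) k / 2

theorem finalDensity_eq (ω : ℕ → ℕ) (m : ℕ) : finalDensity (m + 1) (braceletSandpile m ω) =
    2 * ((finalPairs ω m : ℝ) / m) + (∑ k ∈ Finset.range m, ((ω k % 2 : ℕ) : ℝ)) / m := by
  have hG := Multigraph.isDoubledPath_bracelet m
  rw [finalDensity, Multigraph.density_eq_sum_profile (braceletEquiv m), finalPairs,
    ← mul_div_assoc, ← add_div]
  congr 1
  push_cast [Finset.mul_sum]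
  rw [← Finset.sum_add_distrib]
  refine Finset.sum_congr rfl fun k hk => ?_
  rw [Finset.mem_range] at hk
  have h := hG.profile_stabilization_mod_two (braceletSandpile m ω) hk
  rw [profile_braceletSandpile ω hk] at h
  rw [← h]
  exact_mod_cast (Nat.div_add_mod _ 2).symm

theorem tendsto_finalPairs {ω : ℕ → ℕ} {μ : ℝ}
    (h : Tendsto (fun n : ℕ => (∑ k ∈ Finset.range n, ((ω k / 2 : ℕ) : ℝ)) / n) atTop (𝓝 μ)) :
    Tendsto (fun m : ℕ => (finalPairs ω m : ℝ) / m) atTop (𝓝 (min 1 μ)) := by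
  set c := min 1 μ with hc
  have hupper : Tendsto (fun m : ℕ =>
      min 1 ((∑ k ∈ Finset.range m, ((ω k / 2 : ℕ) : ℝ)) / m)) atTop (𝓝 c) :=
    tendsto_const_nhds.min h
  have hle : ∀ᶠ m : ℕ in atTop, (finalPairs ω m : ℝ) / m ≤
      min 1 ((∑ k ∈ Finset.range m, ((ω k / 2 : ℕ) : ℝ)) / m) := by
    filter_upwards [eventually_gt_atTop 0] with m hm
    have hG := Multigraph.isDoubledPath_bracelet m
    have hm' : (0 : ℝ) < m := by exact_mod_cast hm
    refine le_min ((div_le_one hm').2 ?_) ?_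
    · have h1 : finalPairs ω m ≤ (Finset.range m).card • 1 :=
        Finset.sum_le_card_nsmul _ _ _ fun k hk => by
          have := hG.profile_stabilization_lt (braceletSandpile m ω) (Finset.mem_range.1 hk)
          omega
      rw [Finset.card_range, smul_eq_mul, mul_one] at h1
      exact_mod_cast h1
    · gcongr
      have h1 := hG.sum_pairs_stabilization_le (braceletSandpile m ω)
      have h2 : ∑ k ∈ Finset.range m, Multigraph.profile (braceletEquiv m)
          (braceletSandpile m ω) k / 2 = ∑ k ∈ Finset.range m, ω k / 2 :=
        Finset.sum_congr rfl fun k hk => by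
          rw [profile_braceletSandpile ω (Finset.mem_range.1 hk)]
      exact_mod_cast h1.trans h2.le
  refine tendsto_order.2 ⟨fun a ha => ?_, fun a ha => ?_⟩
  · obtain ⟨C, hC⟩ := exists_abs_sub_le_of_tendsto_div h (ε := (c - a) / 4) (by linarith)
    filter_upwards [eventually_gt_atTop 0,
      (tendsto_natCast_atTop_atTop (R := ℝ)).eventually_gt_atTop ((2 + 2 * C) / ((c - a) / 2))]
      with m hm hm2
    have hG := Multigraph.isDoubledPath_bracelet m
    have hm' : (0 : ℝ) < m := by exact_mod_cast hm
    have hlow := hG.le_sum_pairs_stabilization (braceletSandpile m ω) (c := c)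
      (δ := 2 * ((c - a) / 4 * m + C)) (min_le_left 1 μ) fun i j hij hj => by
        rw [Finset.sum_congr rfl fun k hk => by
          rw [profile_braceletSandpile ω (by rw [Finset.mem_Ico] at hk; omega)],
          Finset.sum_Ico_eq_sub _ hij]
        have h1 := abs_le.1 (hC i)
        have h2 := abs_le.1 (hC j)
        have hij' : (i : ℝ) ≤ j := by exact_mod_cast hij
        have hj' : (j : ℝ) ≤ m := by exact_mod_cast hj
        have h3 : c * ((j : ℝ) - i) ≤ μ * ((j : ℝ) - i) :=
          mul_le_mul_of_nonneg_right (min_le_right 1 μ) (by linarith)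
        have h4 : (c - a) / 4 * i ≤ (c - a) / 4 * m :=
          mul_le_mul_of_nonneg_left (by linarith) (by linarith)
        have h5 : (c - a) / 4 * j ≤ (c - a) / 4 * m :=
          mul_le_mul_of_nonneg_left hj' (by linarith)
        linarith [h1.2, h2.1]
    rw [div_lt_iff₀ (by linarith)] at hm2
    rw [lt_div_iff₀ hm']
    have h6 : (finalPairs ω m : ℝ) = ∑ k ∈ Finset.range m, ((Multigraph.profile (braceletEquiv m)
        ((bracelet (m + 1)).stabilization (braceletSandpile m ω)) k / 2 : ℕ) : ℝ) :=
      Nat.cast_sum _ _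
    rw [h6]
    linarith
  · filter_upwards [hle, hupper.eventually (gt_mem_nhds ha)] with m h1 h2
    exact h1.trans_lt h2

theorem limitDensity_eq (r : ℝ) :
    limitDensity r = 2 * min 1 ((r - poissonOdd r) / 2) + poissonOdd r := by
  rw [limitDensity, mul_min_of_nonneg _ _ (by norm_num : (0 : ℝ) ≤ 2), ← min_add_add_right,
    min_comm]
  congr 1
  · unfold poissonOdd; ring
  · ring

theorem ae_tendsto_finalDensity (r : ℝ≥0) : ∀ᵐ ω ∂poissonField ℕ r,
    Tendsto (fun m : ℕ => finalDensity (m + 1) (braceletSandpile m ω)) atTop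
      (𝓝 (limitDensity r)) := by
  have h1 := poissonField_ae_tendsto_average r Function.injective_id (integrable_div_two r)
  have h2 := poissonField_ae_tendsto_average r Function.injective_id (integrable_mod_two r)
  rw [integral_div_two_poissonMeasure] at h1
  rw [integral_mod_two_poissonMeasure] at h2
  filter_upwards [h1, h2] with ω h1 h2
  simp_rw [finalDensity_eq, limitDensity_eq]
  exact ((tendsto_finalPairs h1).const_mul 2).add h2

theorem tendsto_measure_finalDensity (r : ℝ≥0) {ε : ℝ} (hε : 0 < ε) :
    Tendsto (fun n : ℕ => poissonField {v : ZMod n // v ∉ ({0} : Set (ZMod n))} r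
      {σ | ε ≤ |finalDensity n σ - limitDensity r|}) atTop (𝓝 0) := by
  rw [← tendsto_add_atTop_iff_nat 1]
  have hmeas : ∀ m, Measurable (braceletSandpile m) := fun m =>
    measurable_pi_lambda _ fun v => measurable_pi_apply _
  have hmap : ∀ m, (poissonField ℕ r).map (braceletSandpile m) = poissonField _ r := fun m =>
    Measure.map_infinitePi_infinitePi_of_inj (P := fun _ : ℕ => poissonMeasure r)
      (f := fun v => (braceletEquiv m v : ℕ)) (Fin.val_injective.comp (braceletEquiv m).injective)
  have hae := tendstoInMeasure_of_tendsto_ae (μ := poissonField ℕ r)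
    (f := fun m ω => finalDensity (m + 1) (braceletSandpile m ω)) (g := fun _ => limitDensity r)
    (fun m => ((Measurable.of_discrete (f := finalDensity (m + 1))).comp
      (hmeas m)).aestronglyMeasurable) (ae_tendsto_finalDensity r)
  refine (tendstoInMeasure_iff_norm.1 hae ε hε).congr fun m => ?_
  rw [← hmap m, Measure.map_apply (hmeas m) MeasurableSet.of_discrete]
  rfl

theorem mainTheorem1 :
    ∃ ζc : ℝ,
      (infiniteBracelet.IsThresholdDensity ζc ∧
        (∀ ζ : ℝ, (0 < ζ ∧ ζ = 5 / 2 - 1 / 2 * Real.exp (-2 * ζ)) ↔ ζ = ζc) ∧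
        |ζc - 2.496608| < 0.0000005) ∧
      (infiniteBracelet.HasStationaryDensity (5 / 2) ∧
        Tendsto (fun n : ℕ => (bracelet n).stationaryDensity {0}) atTop (𝓝 (5 / 2))) ∧
      ((∀ r : ℝ≥0, 0 < r → ∀ ε : ℝ, 0 < ε →
          Tendsto (fun n : ℕ => poissonField {v : ZMod n // v ∉ ({0} : Set (ZMod n))} r
            {σ | ε ≤ |finalDensity n σ - limitDensity r|}) atTop (𝓝 0)) ∧
        (∀ x : ℝ, 0 < x → limitDensity x = if x ≤ ζc then x else (5 - Real.exp (-2 * x)) / 2) ∧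
        HasSecondOrderTransitionAt limitDensity ζc) := by
  obtain ⟨c, hc1, hc2, h0⟩ := exists_deficit_zero
  have hc : 0 < c := by linarith
  refine ⟨c, ⟨Multigraph.isThresholdDensity_infiniteBracelet hc.le h0, fun ζ => ⟨?_, ?_⟩, ?_⟩,
    ⟨Multigraph.hasStationaryDensity_infiniteBracelet,
      Multigraph.tendsto_stationaryDensity_bracelet⟩,
    fun r _ ε hε => tendsto_measure_finalDensity r hε, fun x hx => ?_,
    hasSecondOrderTransitionAt_limitDensity hc h0⟩
  · rintro ⟨hζ, heq⟩
    have hζ0 : deficit ζ = 0 := by unfold deficit; linarith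
    exact strictAntiOn_deficit.injOn (mem_Ici.2 hζ.le) (mem_Ici.2 hc.le) (hζ0.trans h0.symm)
  · rintro rfl
    refine ⟨hc, ?_⟩
    unfold deficit at h0
    linarith
  · rw [abs_lt]
    constructor <;> linarith
  · split_ifs with h
    · refine limitDensity_of_deficit_nonneg ?_
      rcases h.eq_or_lt with rfl | h
      · exact h0.ge
      · exact (deficit_pos_of_lt h0 hx.le h).le
    · exact limitDensity_of_deficit_nonpos (deficit_neg_of_lt h0 hc.le (not_le.1 h)).le
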